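/- **Theorem 3.1.** Consider the linear regression $X_t=\mathbf x_t^\top\boldsymbol\beta_t+e_t$, $t\ge 1$, with random regressors $\mathbf x_t\in\mathbb R^d$, random errors $e_t\in\mathbb R$ and nonrandom coefficients $\boldsymbol\beta_t\in\mathbb R^d$, and suppose that there is no parameter change: $\boldsymbol\beta_1=\dots=\boldsymbol\beta_T$ for every $T$. Assume the following. 1. $t_T$ are real numbers with $t_T\to\infty$ and $t_T/T\to0$ as $T\to\infty$. 2. There are $\sigma>0$, $0<\kappa<1/2$ and, for each $T$, independent Wiener processes $\{W_{T,1}(x),0\le x\le T/2\}$ and $\{W_{T,2}(x),0\le x\le T/2\}$ such that, as $T\to\infty$, $$\sup_{1\le x\le T/2}x^{-\kappa}\Big|\sum_{s=1}^{\lfloor x\rfloor}e_s-\sigma W_{T,1}(x)\Big|=O_P(1),\qquad \sup_{T/2\le x\le T-1}(T-x)^{-\kappa}\Big|\sum_{s=\lfloor x\rfloor+1}^{T}e_s-\sigma W_{T,2}(T-x)\Big|=O_P(1).$$ 3. The sequences $\{\mathbf x_t\}_{t\ge0}$ and $\{e_t\}_{t\ge0}$ are independent of each other and have finite second moments. 4.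 $\{\mathbf x_t\}$ is stationary and ergodic, and for some $c>0$ and $\zeta>2$ every coordinate $i$ satisfies $|\mathrm{cov}(\mathbf x_0(i),\mathbf x_t(i))|\le c(t+1)^{-\zeta}$ for all $t\ge0$. 5. $Ee_0=0$ and, for some $c>0$ and $\zeta>2$, $|Ee_te_s|\le c(|t-s|+1)^{-\zeta}$ for all $t,s\ge 0$. 6. The matrix $\mathbf C_z=E\,\mathbf x_0\mathbf x_0^\top$ (the almost sure limit of $T^{-1}\mathbf Z_T^\top\mathbf Z_T$, where $\mathbf Z_T=[\mathbf x_1,\dots,\mathbf x_T]^\top$) is nonsingular. Let $\hat{\boldsymbol\beta}_T=(\mathbf Z_T^\top\mathbf Z_T)^{-1}\mathbf Z_T^\top(X_1,\dots,X_T)^\top$ be the least squares estimator and $\hat e_t=X_t-\mathbf x_t^\top\hat{\boldsymbol\beta}_T$, $1\le t\le T$, the residuals. (Where $\mathbf Z_T^\top\mathbf Z_T$ is singular, or no integer $t$ satisfies $t_T\le t\le T-t_T$, the inverse, respectively the maximum below, is read as $0$; this does not affect the limit.) Then, as $T\to\infty$, $$\frac{t_T^{1/2}}{\sigma}\max_{t_T\le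 t\le T-t_T}\left|\frac1t\sum_{s=1}^t\hat e_s-\frac1{T-t}\sum_{s=t+1}^T\hat e_s\right|\ \xrightarrow{\ \mathcal D\ }\ \max(\xi_1,\xi_2),$$ the maximum being over integers $t$, where $\xi_1,\xi_2$ are independent and each has the distribution of $\sup_{0\le u\le1}|W(u)|$ for a Wiener process $W$ on $[0,1]$. -/

import Mathlib

open MeasureTheory ProbabilityTheory Filter Topology
open scoped ENNReal NNReal Matrix

noncomputable section

/-- `W` restricted to the time interval `[0, a]` is a (standard) Wiener process under `P`. -/
structure IsWienerOn {Ω : Type*} [MeasurableSpace Ω] (P : Measure Ω) (a : ℝ) (W : ℝ → Ω → ℝ) :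
    Prop where
  zero : ∀ᵐ ω ∂P, W 0 ω = 0
  indep_increments : HasIndepIncrements (fun t : Set.Icc (0 : ℝ) a => W t) P
  gaussian_increments : ∀ s t : ℝ, 0 ≤ s → s ≤ t → t ≤ a →
    HasLaw (fun ω => W t ω - W s ω) (gaussianReal 0 (t - s).toNNReal) P
  continuous_paths : ∀ᵐ ω ∂P, ContinuousOn (fun t => W t ω) (Set.Icc 0 a)

/-- `Y T = O_P(1)` as `T → ∞`, for `[0, ∞]`-valued `Y T`. -/
def IsBigOProbOne {Ω : Type*} [MeasurableSpace Ω] (P : Measure Ω) (Y : ℕ → Ω → ℝ≥0∞) : Prop :=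
  ∀ ε : ℝ≥0∞, 0 < ε → ∃ M : ℝ≥0, ∀ᶠ T : ℕ in atTop, P {ω | (M : ℝ≥0∞) < Y T ω} ≤ ε

/-- Approximation of the partial sums of `e`, from the left end and from the right end of the
sample `1, …, T`, by independent Wiener processes on `[0, T/2]`, with scale `σ` and a rate
`κ < 1/2`. -/
def WienerApproximation {Ω : Type*} [MeasurableSpace Ω] (P : Measure Ω) (e : ℕ → Ω → ℝ) (σ : ℝ) :
    Prop :=
  ∃ (κ : ℝ) (W₁ W₂ : ℕ → ℝ → Ω → ℝ), 0 < κ ∧ κ < 1 / 2 ∧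
    (∀ T : ℕ, IsWienerOn P ((T : ℝ) / 2) (W₁ T) ∧ IsWienerOn P ((T : ℝ) / 2) (W₂ T) ∧
      IndepFun (fun ω (u : Set.Icc (0 : ℝ) ((T : ℝ) / 2)) => W₁ T u ω)
        (fun ω (u : Set.Icc (0 : ℝ) ((T : ℝ) / 2)) => W₂ T u ω) P) ∧
    IsBigOProbOne P (fun T ω => ⨆ x ∈ Set.Icc (1 : ℝ) ((T : ℝ) / 2),
      ENNReal.ofReal (x ^ (-κ) * |∑ s ∈ Finset.Icc 1 ⌊x⌋₊, e s ω - σ * W₁ T x ω|)) ∧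
    IsBigOProbOne P (fun T ω => ⨆ x ∈ Set.Icc ((T : ℝ) / 2) ((T : ℝ) - 1),
      ENNReal.ofReal (((T : ℝ) - x) ^ (-κ) *
        |∑ s ∈ Finset.Icc (⌊x⌋₊ + 1) T, e s ω - σ * W₂ T ((T : ℝ) - x) ω|))

/-- The sequence `x` is (strictly) stationary and ergodic: the one-sided shift preserves the law
of `x` on the sequence space and is ergodic for it. -/
def IsStationaryErgodic {Ω E : Type*} [MeasurableSpace Ω] [MeasurableSpace E] (P : Measure Ω)
    (x : ℕ → Ω → E) : Prop :=
  Ergodic (fun (f : ℕ → E) (n : ℕ) => f (n + 1)) (P.map (fun ω (n : ℕ) => x n ω))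

/-- The second moment matrix `E x₀ x₀ᵀ`, which is the almost sure limit of `Zᵀ Z / T` for
stationary ergodic square integrable regressors. -/
def secondMomentMatrix {Ω : Type*} [MeasurableSpace Ω] (P : Measure Ω) {d : ℕ}
    (x : ℕ → Ω → Fin d → ℝ) : Matrix (Fin d) (Fin d) ℝ :=
  Matrix.of fun i j => ∫ ω, x 0 ω i * x 0 ω j ∂P

/-- The design matrix with rows `x 1, …, x T`. -/
def designMatrix {d : ℕ} (x : ℕ → Fin d → ℝ) (T : ℕ) : Matrix (Finset.Icc 1 T) (Fin d) ℝ :=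
  Matrix.of fun t i => x t i

/-- The least squares estimator `(Zᵀ Z)⁻¹ Zᵀ X` from the observations at times `1, …, T`. -/
def olsEstimator {d : ℕ} (x : ℕ → Fin d → ℝ) (X : ℕ → ℝ) (T : ℕ) : Fin d → ℝ :=
  ((designMatrix x T)ᵀ * designMatrix x T)⁻¹ *ᵥ
    ((designMatrix x T)ᵀ *ᵥ fun t : Finset.Icc 1 T => X t)

/-- The residual at time `t` of the least squares fit to the observations at times `1, …, T`. -/
def olsResidual {d : ℕ} (x : ℕ → Fin d → ℝ) (X : ℕ → ℝ) (T t : ℕ) : ℝ :=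
  X t - x t ⬝ᵥ olsEstimator x X T

/-- The Rényi statistic of `y 1, …, y T` with trimming parameter `τ`: the maximum over the integers
`t` with `τ ≤ t ≤ T - τ` of the absolute difference of the means before and after `t`. -/
def renyiStatistic (y : ℕ → ℝ) (T : ℕ) (τ : ℝ) : ℝ :=
  ⨆ t : {t : ℕ // τ ≤ (t : ℝ) ∧ (t : ℝ) ≤ (T : ℝ) - τ},
    |1 / (t : ℝ) * ∑ s ∈ Finset.Icc 1 (t : ℕ), y s
      - 1 / ((T : ℝ) - (t : ℝ)) * ∑ s ∈ Finset.Icc ((t : ℕ) + 1) T, y s|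

end

/-! Without a parameter change, the residuals are `e s - x s ⬝ᵥ δ`, where `δ` is the estimation
error, as long as the Gram matrix is invertible. The difference of means is linear, so the estimator
contributes the mean differences of the regressors times `δ`. These mean differences ignore centring
and are bounded in probability uniformly in `t` (`exists_dominating_running_mean`). The error `δ` is
of order `T^(-1/2)`: the normalized Gram matrix converges by the mean ergodic theorem, and the sums
of `x s j * e s` have variance linear in `T`. After multiplication by `√τ` this contribution is of
order `√(τ/T)` and disappears (`exists_meanDifference_residual_bound`).

For the errors, suppose that `t ≤ T/2`. The mean over the long side is of order `T^(-1/2)`, again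
negligible. The mean over the short side is `σ W₁ t / t` up to `t^(κ-1)`, which after scaling is at
most `τ^(κ-1/2) → 0`. Near the right end `W₂` appears with the opposite sign, which absolute values
remove (`exists_meanDifference_error_bound`, `abs_mul_renyiStatistic_sub_max_le`).

It remains to find the limit of the maxima of `√τ |Wᵢ t| / t`. By time inversion and scaling, each
has the law of the maximum of `|W (τ/t)|` for one fixed Wiener process. The points `τ/t` fill `[0,
1]`, so this converges along every continuous path to the supremum of `|W|`. Independence of `W₁`
and `W₂` gives the joint limit (`tendstoInDistribution_max_halfMax`), and a Slutsky argument
concludes. -/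

/-! ### Centred Gaussian vectors and their covariances. -/

section Gaussian

variable {Ω Ω' ι : Type*} [MeasurableSpace Ω] [MeasurableSpace Ω'] [Fintype ι]
  {P : Measure Ω} {P' : Measure Ω'}

lemma ProbabilityTheory.HasGaussianLaw.isGaussian_map_toLp {X : ι → Ω → ℝ}
    (hX : HasGaussianLaw (fun ω i => X i ω) P) :
    IsGaussian (P.map fun ω => WithLp.toLp 2 (X · ω)) :=
  (hX.map (PiLp.continuousLinearEquiv 2 ℝ fun _ : ι => ℝ).symm.toContinuousLinearMap).isGaussian_map

lemma ProbabilityTheory.HasGaussianLaw.integral_map_toLp_eq_zero {X : ι → Ω → ℝ}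
    (hX : HasGaussianLaw (fun ω i => X i ω) P) (h0 : ∀ i, ∫ ω, X i ω ∂P = 0) :
    (P.map fun ω => WithLp.toLp 2 (X · ω))[id] = (0 : EuclideanSpace ℝ ι) := by
  have hL : HasGaussianLaw (fun ω => (WithLp.toLp 2 (X · ω) : EuclideanSpace ℝ ι)) P :=
    ⟨hX.isGaussian_map_toLp⟩
  rw [integral_map hL.aemeasurable (by fun_prop)]
  ext i
  have := (EuclideanSpace.proj (𝕜 := ℝ) i).integral_comp_comm hL.integrable
  simp only [id_eq]
  refine Eq.trans this.symm ?_
  simpa using h0 i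

/-- Two centered Gaussian vectors with the same covariances have the same law. -/
lemma ProbabilityTheory.HasGaussianLaw.identDistrib_of_covariance_eq
    {X : ι → Ω → ℝ} {Y : ι → Ω' → ℝ}
    (hX : HasGaussianLaw (fun ω i => X i ω) P) (hY : HasGaussianLaw (fun ω i => Y i ω) P')
    (hX0 : ∀ i, ∫ ω, X i ω ∂P = 0) (hY0 : ∀ i, ∫ ω, Y i ω ∂P' = 0)
    (hcov : ∀ i j, cov[X i, X j; P] = cov[Y i, Y j; P']) :
    IdentDistrib (fun ω i => X i ω) (fun ω i => Y i ω) P P' := by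
  refine ⟨hX.aemeasurable, hY.aemeasurable, ?_⟩
  -- On a Euclidean space a Gaussian law is determined by its mean and covariance form, so both laws
  -- are transported there.
  apply (MeasurableEquiv.toLp 2 (ι → ℝ)).map_measurableEquiv_injective
  rw [AEMeasurable.map_map_of_aemeasurable (by fun_prop) hX.aemeasurable,
    AEMeasurable.map_map_of_aemeasurable (by fun_prop) hY.aemeasurable]
  have := hX.isGaussian_map_toLp
  have := hY.isGaussian_map_toLp
  have := hX.isProbabilityMeasure
  have := hY.isProbabilityMeasure
  change (P.map fun ω => WithLp.toLp 2 (X · ω)) = P'.map fun ω => WithLp.toLp 2 (Y · ω)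
  apply IsGaussian.ext
  · rw [hX.integral_map_toLp_eq_zero hX0, hY.integral_map_toLp_eq_zero hY0]
  · ext x y
    rw [covarianceBilin_apply_pi fun i => (hX.eval i).memLp_two,
      covarianceBilin_apply_pi fun i => (hY.eval i).memLp_two]
    simp_rw [hcov]

end Gaussian

/-! ### Covariances and finite-dimensional laws of Wiener processes. -/

namespace IsWienerOn

variable {Ω Ω' : Type*} [MeasurableSpace Ω] [MeasurableSpace Ω'] {P : Measure Ω} {P' : Measure Ω'}
  {a b : ℝ} {V : ℝ → Ω → ℝ} {W : ℝ → Ω' → ℝ}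

lemma hasLaw_eval (hV : IsWienerOn P a V) {t : ℝ} (h0 : 0 ≤ t) (ha : t ≤ a) :
    HasLaw (V t) (gaussianReal 0 t.toNNReal) P := by
  have := hV.gaussian_increments 0 t le_rfl h0 ha
  rw [sub_zero] at this
  refine this.congr ?_
  filter_upwards [hV.zero] with ω hω
  simp [hω]

lemma aemeasurable (hV : IsWienerOn P a V) {t : ℝ} (h0 : 0 ≤ t) (ha : t ≤ a) :
    AEMeasurable (V t) P :=
  (hV.hasLaw_eval h0 ha).aemeasurable

lemma isGaussianProcess (hV : IsWienerOn P a V) (ha : 0 ≤ a) :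
    IsGaussianProcess (fun t : Set.Icc (0 : ℝ) a => V t) P := by
  -- Time `0` serves as the bottom element at which the process starts from `0`; independent
  -- Gaussian increments from there make the process Gaussian.
  let _ : OrderBot (Set.Icc (0 : ℝ) a) :=
    { bot := ⟨0, le_rfl, ha⟩
      bot_le := fun t => t.2.1 }
  exact hV.indep_increments.isGaussianProcess
    (fun t => (hV.hasLaw_eval t.2.1 t.2.2).hasGaussianLaw) hV.zero

lemma integral_eq_zero (hV : IsWienerOn P a V) {t : ℝ} (h0 : 0 ≤ t) (ha : t ≤ a) :
    ∫ ω, V t ω ∂P = 0 := by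
  rw [(hV.hasLaw_eval h0 ha).integral_eq, integral_id_gaussianReal]

lemma memLp_two (hV : IsWienerOn P a V) {t : ℝ} (h0 : 0 ≤ t) (ha : t ≤ a) :
    MemLp (V t) 2 P :=
  (hV.hasLaw_eval h0 ha).hasGaussianLaw.memLp_two

/-- Write `V t` as `V s` plus an increment independent of `V s`; only the variance of `V s`
survives. -/
lemma covariance_of_le (hV : IsWienerOn P a V) {s t : ℝ} (h0 : 0 ≤ s) (hst : s ≤ t)
    (ha : t ≤ a) : cov[V s, V t; P] = s := by
  have h1 : IndepFun (V s) (V t - V s) P :=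
    hV.indep_increments.indepFun_eval_sub (r := ⟨0, le_rfl, h0.trans (hst.trans ha)⟩)
      (s := ⟨s, h0, hst.trans ha⟩) (t := ⟨t, h0.trans hst, ha⟩) h0 hst hV.zero
  have law := hV.hasLaw_eval h0 (hst.trans ha)
  have := law.isProbabilityMeasure
  have ms := hV.memLp_two h0 (hst.trans ha)
  have mt := hV.memLp_two (h0.trans hst) ha
  have h2 : V t = V t - V s + V s := by simp
  rw [h2, covariance_add_right ms (mt.sub ms) ms, h1.covariance_eq_zero ms (mt.sub ms),
    covariance_self ms.aestronglyMeasurable.aemeasurable, law.variance_eq,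
    variance_id_gaussianReal]
  simp [h0]

lemma covariance_eq_min (hV : IsWienerOn P a V) {s t : ℝ} (hs : s ∈ Set.Icc 0 a)
    (ht : t ∈ Set.Icc 0 a) : cov[V s, V t; P] = min s t := by
  rcases le_total s t with h | h
  · rw [min_eq_left h, hV.covariance_of_le hs.1 h ht.2]
  · rw [min_eq_right h, covariance_comm, hV.covariance_of_le ht.1 h hs.2]

lemma isProbabilityMeasure (hV : IsWienerOn P a V) (ha : 0 ≤ a) : IsProbabilityMeasure P :=
  (hV.hasLaw_eval le_rfl ha).isProbabilityMeasure

lemma hasGaussianLaw_mul {ι : Type*} [Fintype ι] (hV : IsWienerOn P a V) (ha : 0 ≤ a)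
    (c t : ι → ℝ) (ht : ∀ i, t i ∈ Set.Icc 0 a) :
    HasGaussianLaw (fun ω i => c i * V (t i) ω) P := by
  classical
  have h := ((hV.isGaussianProcess ha).comp_right fun i : ι => (⟨t i, ht i⟩ : Set.Icc (0 : ℝ) a)).smul c
  have h2 := h.hasGaussianLaw Finset.univ
  let L : ({i // i ∈ (Finset.univ : Finset ι)} → ℝ) →L[ℝ] (ι → ℝ) :=
    ContinuousLinearMap.pi fun i => ContinuousLinearMap.proj ⟨i, Finset.mem_univ i⟩
  exact h2.map L

/-- Rescaled Wiener processes have the same finite-dimensional laws when the covariances agree. -/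
lemma identDistrib_mul {ι : Type*} [Fintype ι] (hV : IsWienerOn P a V) (hW : IsWienerOn P' b W)
    (ha : 0 ≤ a) (hb : 0 ≤ b) (c t u : ι → ℝ) (ht : ∀ i, t i ∈ Set.Icc 0 a)
    (hu : ∀ i, u i ∈ Set.Icc 0 b)
    (h : ∀ i j, c i * c j * min (t i) (t j) = min (u i) (u j)) :
    IdentDistrib (fun ω i => c i * V (t i) ω) (fun ω i => W (u i) ω) P P' := by
  have hW' := hW.hasGaussianLaw_mul hb (fun _ => 1) u hu
  simp only [one_mul] at hW'
  refine (hV.hasGaussianLaw_mul ha c t ht).identDistrib_of_covariance_eq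
    (X := fun i ω => c i * V (t i) ω) (Y := fun i => W (u i)) hW' ?_ ?_ ?_
  · intro i
    rw [integral_const_mul, hV.integral_eq_zero (ht i).1 (ht i).2, mul_zero]
  · exact fun i => hW.integral_eq_zero (hu i).1 (hu i).2
  · intro i j
    have := hV.isProbabilityMeasure ha
    rw [covariance_const_mul_left, covariance_const_mul_right,
      hV.covariance_eq_min (ht i) (ht j), hW.covariance_eq_min (hu i) (hu j), ← h i j, mul_assoc]

end IsWienerOn

/-! ### Calculus of boundedness and convergence in probability. -/

section InProbability

variable {Ω Ω' : Type*} [MeasurableSpace Ω] [MeasurableSpace Ω'] {P : Measure Ω} {P' : Measure Ω'}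

/-- `Y T = O_P(1)` as `T → ∞`, for real-valued `Y T`. -/
def BoundedInProb (P : Measure Ω) (Y : ℕ → Ω → ℝ) : Prop :=
  ∀ ε : ℝ≥0∞, 0 < ε → ∃ M : ℝ, ∀ᶠ T : ℕ in atTop, P {ω | M < |Y T ω|} ≤ ε

namespace BoundedInProb

variable {Y Z : ℕ → Ω → ℝ}

lemma mono (hY : BoundedInProb P Y) (h : ∀ᶠ T in atTop, ∀ᵐ ω ∂P, |Z T ω| ≤ |Y T ω|) :
    BoundedInProb P Z := by
  intro ε hε
  obtain ⟨M, hM⟩ := hY ε hε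
  refine ⟨M, ?_⟩
  filter_upwards [hM, h] with T h1 h2
  refine le_trans (measure_mono_ae ?_) h1
  filter_upwards [h2] with ω hω h3
  exact lt_of_lt_of_le h3 hω

lemma add (hY : BoundedInProb P Y) (hZ : BoundedInProb P Z) :
    BoundedInProb P fun T ω => Y T ω + Z T ω := by
  intro ε hε
  obtain ⟨M, hM⟩ := hY (ε / 2) (ENNReal.half_pos hε.ne')
  obtain ⟨N, hN⟩ := hZ (ε / 2) (ENNReal.half_pos hε.ne')
  refine ⟨M + N, ?_⟩
  filter_upwards [hM, hN] with T h1 h2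
  calc P {ω | M + N < |Y T ω + Z T ω|}
      ≤ P ({ω | M < |Y T ω|} ∪ {ω | N < |Z T ω|}) := by
        refine measure_mono fun ω hω => ?_
        by_contra hcon
        simp only [Set.mem_union, Set.mem_ofPred_eq, not_or, not_lt] at hcon hω
        linarith [abs_add_le (Y T ω) (Z T ω)]
    _ ≤ ε / 2 + ε / 2 := (measure_union_le _ _).trans (add_le_add h1 h2)
    _ = ε := ENNReal.add_halves ε

lemma mul (hY : BoundedInProb P Y) (hZ : BoundedInProb P Z) :
    BoundedInProb P fun T ω => Y T ω * Z T ω := by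
  intro ε hε
  obtain ⟨M, hM⟩ := hY (ε / 2) (ENNReal.half_pos hε.ne')
  obtain ⟨N, hN⟩ := hZ (ε / 2) (ENNReal.half_pos hε.ne')
  refine ⟨M * N, ?_⟩
  filter_upwards [hM, hN] with T h1 h2
  calc P {ω | M * N < |Y T ω * Z T ω|}
      ≤ P ({ω | M < |Y T ω|} ∪ {ω | N < |Z T ω|}) := by
        refine measure_mono fun ω hω => ?_
        by_contra hcon
        simp only [Set.mem_union, Set.mem_ofPred_eq, not_or, not_lt, abs_mul] at hcon hω
        exact absurd (mul_le_mul hcon.1 hcon.2 (abs_nonneg _) ((abs_nonneg _).trans hcon.1))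
          (not_le.2 hω)
    _ ≤ ε / 2 + ε / 2 := (measure_union_le _ _).trans (add_le_add h1 h2)
    _ = ε := ENNReal.add_halves ε

lemma const (c : ℝ) : BoundedInProb P fun _ _ => c := by
  intro ε _
  exact ⟨|c|, by simp⟩

lemma sum {ι : Type*} (s : Finset ι) {Y : ι → ℕ → Ω → ℝ} (h : ∀ i ∈ s, BoundedInProb P (Y i)) :
    BoundedInProb P fun T ω => ∑ i ∈ s, Y i T ω := by
  classical
  induction s using Finset.induction_on with
  | empty => simpa using const (P := P) 0
  | insert i s hi ih =>
    simp_rw [Finset.sum_insert hi]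
    exact (h i (by simp)).add (ih fun j hj => h j (by simp [hj]))

lemma abs (hY : BoundedInProb P Y) : BoundedInProb P fun T ω => |Y T ω| :=
  hY.mono (by simp)

/-- Chebyshev's inequality; `|C| + 1` replaces `C` to keep the threshold positive. -/
lemma of_integral_sq_le {C : ℝ}
    (h : ∀ᶠ T in atTop, Integrable (fun ω => Y T ω ^ 2) P ∧ ∫ ω, Y T ω ^ 2 ∂P ≤ C)
    [IsFiniteMeasure P] : BoundedInProb P Y := by
  intro ε hε
  rcases eq_or_ne ε ∞ with rfl | hε'
  · exact ⟨0, by simp⟩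
  obtain ⟨r, hr, hrε⟩ : ∃ r : ℝ, 0 < r ∧ ENNReal.ofReal r = ε :=
    ⟨ε.toReal, ENNReal.toReal_pos hε.ne' hε', ENNReal.ofReal_toReal hε'⟩
  have hN : 0 < (|C| + 1) / r := by positivity
  refine ⟨√((|C| + 1) / r), ?_⟩
  filter_upwards [h] with T ⟨h1, h2⟩
  have h3 := mul_meas_ge_le_integral_of_nonneg (.of_forall fun ω => sq_nonneg (Y T ω)) h1
    ((|C| + 1) / r)
  have h4 : P.real {ω | (|C| + 1) / r ≤ Y T ω ^ 2} ≤ r := by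
    have : (|C| + 1) / r * P.real {ω | (|C| + 1) / r ≤ Y T ω ^ 2} ≤ (|C| + 1) / r * r := by
      rw [div_mul_cancel₀ _ hr.ne']
      linarith [le_abs_self C]
    exact le_of_mul_le_mul_left this hN
  rw [← hrε]
  refine (measure_mono fun ω hω => ?_).trans
    ((ENNReal.le_ofReal_iff_toReal_le (measure_ne_top _ _) hr.le).2 h4)
  have h5 : √((|C| + 1) / r) < |Y T ω| := hω
  rw [Real.sqrt_lt' (lt_of_le_of_lt (Real.sqrt_nonneg _) h5), sq_abs] at h5
  exact h5.le

/-- The tails of a single variable under a finite measure vanish, so domination by them is uniform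
in `T`. The variable may live on another space, which suits comparisons in law. -/
lemma of_measure_le [IsFiniteMeasure P'] {Z : Ω' → ℝ} (hZ : AEMeasurable Z P')
    (h : ∀ᶠ T in atTop, ∀ M : ℝ, P {ω | M < |Y T ω|} ≤ P' {ω | M < Z ω}) :
    BoundedInProb P Y := by
  intro ε hε
  have h1 : Tendsto (fun n : ℕ => P' {ω | (n : ℝ) < Z ω}) atTop (𝓝 0) := by
    have h2 := tendsto_measure_iInter_atTop (μ := P') (s := fun n : ℕ => {ω | (n : ℝ) < Z ω})
      (fun n => nullMeasurableSet_lt aemeasurable_const hZ)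
      (fun m n hmn ω (hω : (n : ℝ) < Z ω) => lt_of_le_of_lt (by exact_mod_cast hmn) hω)
      ⟨0, measure_ne_top _ _⟩
    have h3 : ⋂ n : ℕ, {ω | (n : ℝ) < Z ω} = ∅ := by
      refine Set.eq_empty_of_forall_notMem fun ω hω => ?_
      obtain ⟨n, hn⟩ := exists_nat_gt (Z ω)
      exact absurd (Set.mem_iInter.1 hω n) (not_lt.2 hn.le)
    rw [h3, measure_empty] at h2
    exact h2
  obtain ⟨n, hn⟩ := ((tendsto_order.1 h1).2 ε hε).exists
  refine ⟨n, ?_⟩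
  filter_upwards [h] with T hT
  exact (hT n).trans hn.le

lemma tendstoInMeasure_mul (hY : BoundedInProb P Y) {a : ℕ → ℝ} (ha : Tendsto a atTop (𝓝 0)) :
    TendstoInMeasure P (fun T ω => a T * Y T ω) atTop fun _ => 0 := by
  rw [tendstoInMeasure_iff_norm]
  intro δ hδ
  rw [ENNReal.tendsto_nhds_zero]
  intro ε hε
  obtain ⟨M, hM⟩ := hY ε hε
  have h0 : Tendsto (fun T => |a T| * (|M| + 1)) atTop (𝓝 0) := by
    simpa using ha.abs.mul_const (|M| + 1)
  filter_upwards [hM, (tendsto_order.1 h0).2 δ hδ] with T h1 h2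
  refine (measure_mono fun ω hω => ?_).trans h1
  simp only [Set.mem_ofPred_eq, sub_zero, Real.norm_eq_abs, abs_mul] at hω ⊢
  by_contra hcon
  have h3 : |Y T ω| ≤ |M| + 1 := by linarith [not_lt.1 hcon, le_abs_self M]
  have := mul_le_mul_of_nonneg_left h3 (abs_nonneg (a T))
  linarith

end BoundedInProb

lemma IsBigOProbOne.boundedInProb {Y : ℕ → Ω → ℝ≥0∞} (hY : IsBigOProbOne P Y) {Z : ℕ → Ω → ℝ}
    (h : ∀ T ω, ENNReal.ofReal |Z T ω| ≤ Y T ω) : BoundedInProb P Z := by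
  intro ε hε
  obtain ⟨M, hM⟩ := hY ε hε
  refine ⟨M, ?_⟩
  filter_upwards [hM] with T hT
  refine (measure_mono fun ω hω => ?_).trans hT
  refine lt_of_lt_of_le ?_ (h T ω)
  have h1 : (M : ℝ) < |Z T ω| := hω
  rw [← ENNReal.ofReal_coe_nnreal]
  exact (ENNReal.ofReal_lt_ofReal_iff_of_nonneg M.2).2 h1

lemma TendstoInMeasure.add_zero {f g : ℕ → Ω → ℝ}
    (hf : TendstoInMeasure P f atTop fun _ => 0) (hg : TendstoInMeasure P g atTop fun _ => 0) :
    TendstoInMeasure P (fun T ω => f T ω + g T ω) atTop fun _ => 0 := by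
  rw [tendstoInMeasure_iff_norm] at hf hg ⊢
  intro δ hδ
  refine tendsto_of_tendsto_of_tendsto_of_le_of_le tendsto_const_nhds
    (by simpa using (hf (δ / 2) (by positivity)).add (hg (δ / 2) (by positivity)))
    (fun _ => zero_le) fun T => ?_
  refine (measure_mono fun ω hω => ?_).trans (measure_union_le _ _)
  by_contra hcon
  simp only [Set.mem_union, Set.mem_ofPred_eq, not_or, not_le, sub_zero, Real.norm_eq_abs]
    at hcon hω
  linarith [abs_add_le (f T ω) (g T ω)]

/-- Domination outside of events of vanishing probability. -/
lemma TendstoInMeasure.zero_of_le {f g : ℕ → Ω → ℝ} {B : ℕ → Set Ω}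
    (hg : TendstoInMeasure P g atTop fun _ => 0) (hB : Tendsto (fun T => P (B T)) atTop (𝓝 0))
    (h : ∀ᶠ T in atTop, ∀ᵐ ω ∂P, ω ∉ B T → |f T ω| ≤ |g T ω|) :
    TendstoInMeasure P f atTop fun _ => 0 := by
  rw [tendstoInMeasure_iff_norm] at hg ⊢
  intro δ hδ
  refine tendsto_of_tendsto_of_tendsto_of_le_of_le' tendsto_const_nhds
    (by simpa using (hg δ hδ).add hB) (.of_forall fun _ => zero_le) ?_
  filter_upwards [h] with T hT
  refine (measure_mono_ae ?_).trans (measure_union_le _ _)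
  filter_upwards [hT] with ω hω h1
  by_cases h2 : ω ∈ B T
  · exact Or.inr h2
  · left
    have h1' : δ ≤ ‖f T ω - 0‖ := h1
    have h3 := hω h2
    change δ ≤ |g T ω|
    rw [sub_zero, Real.norm_eq_abs] at h1'
    linarith

end InProbability

/-! ### Second moments of sums under decaying correlations, and uniform bounds for running means. -/

section SecondMoments

/-- For fixed `s`, each distance `|t - s|` occurs at most once on either side, so every row is
bounded by twice a convergent series. -/
lemma exists_sum_sum_rpow_abs_sub_le {ζ : ℝ} (hζ : 1 < ζ) : ∃ K : ℝ, 0 ≤ K ∧ ∀ F : Finset ℕ,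
    ∑ s ∈ F, ∑ t ∈ F, (|(t : ℝ) - (s : ℝ)| + 1) ^ (-ζ) ≤ K * F.card := by
  let g : ℕ → ℝ := fun n => ((n : ℝ) + 1) ^ (-ζ)
  have hg0 : ∀ n, 0 ≤ g n := fun n => by positivity
  have hg : Summable g := by
    have h1 : Summable fun n : ℕ => (n : ℝ) ^ (-ζ) := Real.summable_nat_rpow.2 (by linarith)
    simpa [g] using (summable_nat_add_iff 1).2 h1
  refine ⟨2 * ∑' n, g n, mul_nonneg zero_le_two (tsum_nonneg hg0), fun F => ?_⟩
  have key : ∀ s ∈ F, ∑ t ∈ F, (|(t : ℝ) - (s : ℝ)| + 1) ^ (-ζ) ≤ 2 * ∑' n, g n := by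
    intro s _
    have h1 : ∑ t ∈ F with s ≤ t, (|(t : ℝ) - (s : ℝ)| + 1) ^ (-ζ) ≤ ∑' n, g n := by
      have : ∑ t ∈ F with s ≤ t, (|(t : ℝ) - (s : ℝ)| + 1) ^ (-ζ)
          = ∑ n ∈ ({t ∈ F | s ≤ t}).image (· - s), g n := by
        rw [Finset.sum_image]
        · refine Finset.sum_congr rfl fun t ht => ?_
          have hst := (Finset.mem_filter.1 ht).2
          simp only [g]
          rw [Nat.cast_sub hst, abs_of_nonneg (sub_nonneg.2 (by exact_mod_cast hst))]
        · intro t ht t' ht' h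
          simp only [Finset.coe_filter, Set.mem_ofPred_eq] at ht ht' h
          omega
      rw [this]
      exact hg.sum_le_tsum _ fun n _ => hg0 n
    have h2 : ∑ t ∈ F with ¬ s ≤ t, (|(t : ℝ) - (s : ℝ)| + 1) ^ (-ζ) ≤ ∑' n, g n := by
      have : ∑ t ∈ F with ¬ s ≤ t, (|(t : ℝ) - (s : ℝ)| + 1) ^ (-ζ)
          = ∑ n ∈ ({t ∈ F | ¬ s ≤ t}).image (s - ·), g n := by
        rw [Finset.sum_image]
        · refine Finset.sum_congr rfl fun t ht => ?_
          have hst := (not_le.1 (Finset.mem_filter.1 ht).2).le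
          simp only [g]
          rw [Nat.cast_sub hst, abs_sub_comm,
            abs_of_nonneg (sub_nonneg.2 (by exact_mod_cast hst))]
        · intro t ht t' ht' h
          simp only [Finset.coe_filter, Set.mem_ofPred_eq] at ht ht' h
          omega
      rw [this]
      exact hg.sum_le_tsum _ fun n _ => hg0 n
    rw [← Finset.sum_filter_add_sum_filter_not F (fun t => s ≤ t)]
    linarith
  calc _ ≤ ∑ _s ∈ F, 2 * ∑' n, g n := Finset.sum_le_sum key
    _ = _ := by rw [Finset.sum_const, nsmul_eq_mul]; ring

variable {Ω : Type*} [MeasurableSpace Ω] {P : Measure Ω}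

/-- Short memory in the `L²` sense: the second moment of a sum is at most linear in the number of
its terms. -/
structure LinearSecondMoment (P : Measure Ω) (y : ℕ → Ω → ℝ) (C : ℝ) : Prop where
  memLp : ∀ t, MemLp (y t) 2 P
  integral_sq_le : ∀ F : Finset ℕ, ∫ ω, (∑ s ∈ F, y s ω) ^ 2 ∂P ≤ C * F.card

lemma integral_sq_sum {y : ℕ → Ω → ℝ} (hy : ∀ t, MemLp (y t) 2 P) (F : Finset ℕ) :
    ∫ ω, (∑ s ∈ F, y s ω) ^ 2 ∂P = ∑ s ∈ F, ∑ t ∈ F, ∫ ω, y s ω * y t ω ∂P := by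
  have hint : ∀ s t, Integrable (fun ω => y s ω * y t ω) P :=
    fun s t => (hy s).integrable_mul (hy t)
  simp_rw [sq, Finset.sum_mul_sum]
  rw [integral_finsetSum _ fun s _ => integrable_finsetSum _ fun t _ => hint s t]
  exact Finset.sum_congr rfl fun s _ => integral_finsetSum _ fun t _ => hint s t

lemma exists_linearSecondMoment {y : ℕ → Ω → ℝ} (hy : ∀ t, MemLp (y t) 2 P) {c ζ : ℝ}
    (hc : 0 ≤ c) (hζ : 1 < ζ)
    (h : ∀ t s : ℕ, |∫ ω, y t ω * y s ω ∂P| ≤ c * (|(t : ℝ) - (s : ℝ)| + 1) ^ (-ζ)) :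
    ∃ C, LinearSecondMoment P y C := by
  obtain ⟨K, _, hK⟩ := exists_sum_sum_rpow_abs_sub_le hζ
  refine ⟨c * K, hy, fun F => ?_⟩
  rw [integral_sq_sum hy]
  calc ∑ s ∈ F, ∑ t ∈ F, ∫ ω, y s ω * y t ω ∂P
      ≤ ∑ s ∈ F, ∑ t ∈ F, c * (|(t : ℝ) - (s : ℝ)| + 1) ^ (-ζ) := by
        gcongr with s _ t _
        rw [abs_sub_comm]
        exact (le_abs_self _).trans (h s t)
    _ = c * ∑ s ∈ F, ∑ t ∈ F, (|(t : ℝ) - (s : ℝ)| + 1) ^ (-ζ) := by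
        simp_rw [Finset.mul_sum]
    _ ≤ c * (K * F.card) := by gcongr; exact hK F
    _ = c * K * F.card := by ring

namespace LinearSecondMoment

variable {y : ℕ → Ω → ℝ} {C : ℝ}

lemma nonneg (h : LinearSecondMoment P y C) : 0 ≤ C := by
  have := h.integral_sq_le {0}
  simp only [Finset.card_singleton, Nat.cast_one, mul_one] at this
  exact (integral_nonneg fun ω => sq_nonneg _).trans this

/-- The second moment bound holds for arbitrary finite index sets, so it survives time reversal.
Inside `Icc 1 N` the truncated subtraction is injective. The reversed sequence serves the means at
the right end of the sample. -/
lemma integral_sq_reversed_le (h : LinearSecondMoment P y C) {N : ℕ} :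
    ∀ F ⊆ Finset.Icc 1 N, ∫ ω, (∑ s ∈ F, y (N + 1 - s) ω) ^ 2 ∂P ≤ C * F.card := by
  intro F hF
  have hinj : Set.InjOn (fun s => N + 1 - s) (F : Set ℕ) := by
    intro s hs t ht hst
    have h1 := Finset.mem_Icc.1 (hF hs)
    have h2 := Finset.mem_Icc.1 (hF ht)
    simp only at hst
    omega
  have h1 := h.integral_sq_le (F.image fun s => N + 1 - s)
  rw [Finset.card_image_of_injOn hinj] at h1
  simpa [Finset.sum_image hinj] using h1

end LinearSecondMoment

lemma memLp_sum {y : ℕ → Ω → ℝ} (hy : ∀ t, MemLp (y t) 2 P) (F : Finset ℕ) :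
    MemLp (fun ω => ∑ s ∈ F, y s ω) 2 P :=
  memLp_finsetSum F fun s _ => hy s

/-- The running means of a sequence with `LinearSecondMoment` are dominated by a square integrable
function: control them along the squares and bound the gaps crudely. -/
lemma exists_dominating_running_mean {y : ℕ → Ω → ℝ} {C : ℝ} (hC : 0 ≤ C) {N : ℕ}
    (hy : ∀ t, MemLp (y t) 2 P)
    (h : ∀ F ⊆ Finset.Icc 1 N, ∫ ω, (∑ s ∈ F, y s ω) ^ 2 ∂P ≤ C * F.card) :
    ∃ Y : Ω → ℝ, Integrable (fun ω => Y ω ^ 2) P ∧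
      ∫ ω, Y ω ^ 2 ∂P ≤ 10 * C * ∑' k : ℕ, 1 / (k : ℝ) ^ 2 ∧ (∀ ω, 0 ≤ Y ω) ∧
      ∀ ω, ∀ t ∈ Finset.Icc 1 N, |∑ s ∈ Finset.Icc 1 t, y s ω| ≤ t * Y ω := by
  let S : ℕ → Ω → ℝ := fun t ω => ∑ s ∈ Finset.Icc 1 t, y s ω
  -- The at most `2 * k` indices strictly between `k ^ 2` and `(k + 1) ^ 2`, cut at `N` because the
  -- moment bound is available only up to `N`.
  let B : ℕ → Finset ℕ := fun k => Finset.Ioc (k ^ 2) (min (k ^ 2 + 2 * k) N)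
  -- For `t` between two squares, `S t` is `S (k ^ 2)` plus a gap `D`. Then `S t ^ 2 ≤ 2 S(k²)² + 2
  -- D²`, and Cauchy-Schwarz bounds `D²` by `2k` times the sum of squares. Division by `k ^ 4 ≤ t ^
  -- 2` turns this into a bound for the squared mean.
  let q : ℕ → Ω → ℝ := fun k ω =>
    (2 * S (k ^ 2) ω ^ 2 + 4 * k * ∑ s ∈ B k, y s ω ^ 2) / (k : ℝ) ^ 4
  let A : Finset ℕ := {k ∈ Finset.Icc 1 N | k ^ 2 ≤ N}
  let Q : Ω → ℝ := fun ω => ∑ k ∈ A, q k ω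
  have hq0 : ∀ k ω, 0 ≤ q k ω := fun k ω => by
    have : 0 ≤ ∑ s ∈ B k, y s ω ^ 2 := Finset.sum_nonneg fun s _ => sq_nonneg _
    positivity
  have hQ0 : ∀ ω, 0 ≤ Q ω := fun ω => Finset.sum_nonneg fun k _ => hq0 k ω
  have iS : ∀ t, Integrable (fun ω => S t ω ^ 2) P := fun t => (memLp_sum hy _).integrable_sq
  have iB : ∀ k, Integrable (fun ω => ∑ s ∈ B k, y s ω ^ 2) P :=
    fun k => integrable_finsetSum _ fun s _ => (hy s).integrable_sq
  have iq : ∀ k, Integrable (q k) P := fun k =>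
    (((iS _).const_mul 2).add ((iB k).const_mul (4 * k))).div_const _
  have iQ : Integrable Q P := integrable_finsetSum _ fun k _ => iq k
  have eq : ∀ k ∈ A, ∫ ω, q k ω ∂P ≤ 10 * C * (1 / (k : ℝ) ^ 2) := by
    intro k hk
    obtain ⟨hk1, hkN⟩ := Finset.mem_filter.1 hk
    have hk1 : 1 ≤ k := (Finset.mem_Icc.1 hk1).1
    have hkpos : (0 : ℝ) < k := by exact_mod_cast hk1
    have e1 : ∫ ω, S (k ^ 2) ω ^ 2 ∂P ≤ C * (k : ℝ) ^ 2 := by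
      have := h (Finset.Icc 1 (k ^ 2)) (Finset.Icc_subset_Icc_right hkN)
      simpa [S] using this
    have e2 : ∫ ω, ∑ s ∈ B k, y s ω ^ 2 ∂P ≤ C * (2 * k) := by
      rw [integral_finsetSum _ fun s _ => (hy s).integrable_sq]
      calc ∑ s ∈ B k, ∫ ω, y s ω ^ 2 ∂P ≤ ∑ _s ∈ B k, C := by
            refine Finset.sum_le_sum fun s hs => ?_
            have hs' := Finset.mem_Ioc.1 hs
            have := h {s} (by
              rw [Finset.singleton_subset_iff, Finset.mem_Icc]
              exact ⟨by omega, hs'.2.trans (min_le_right _ _)⟩)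
            simpa using this
        _ = C * (B k).card := by rw [Finset.sum_const, nsmul_eq_mul]; ring
        _ ≤ C * (2 * k) := by
            gcongr
            have : (B k).card ≤ 2 * k := by
              simp only [B, Nat.card_Ioc]
              omega
            exact_mod_cast this
    have e3 : ∫ ω, q k ω ∂P = (2 * ∫ ω, S (k ^ 2) ω ^ 2 ∂P
        + 4 * k * ∫ ω, ∑ s ∈ B k, y s ω ^ 2 ∂P) / (k : ℝ) ^ 4 := by
      simp only [q]
      rw [integral_div, integral_add ((iS _).const_mul 2) ((iB k).const_mul (4 * k)),
        integral_const_mul, integral_const_mul]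
    rw [e3]
    -- The constant is `10 = 2 + 4 * 2`, and the resulting bound is summable in `k`.
    calc _ ≤ (2 * (C * (k : ℝ) ^ 2) + 4 * k * (C * (2 * k))) / (k : ℝ) ^ 4 := by gcongr
      _ = 10 * C * (1 / (k : ℝ) ^ 2) := by field_simp; ring
  refine ⟨fun ω => √(Q ω), ?_, ?_, fun ω => Real.sqrt_nonneg _, ?_⟩
  · simpa [Real.sq_sqrt (hQ0 _)] using iQ
  · simp only [Real.sq_sqrt (hQ0 _)]
    rw [integral_finsetSum _ fun k _ => iq k]
    calc ∑ k ∈ A, ∫ ω, q k ω ∂P ≤ ∑ k ∈ A, 10 * C * (1 / (k : ℝ) ^ 2) := Finset.sum_le_sum eq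
      _ = 10 * C * ∑ k ∈ A, 1 / (k : ℝ) ^ 2 := by rw [Finset.mul_sum]
      _ ≤ _ := by
        gcongr
        exact (Real.summable_one_div_nat_pow.2 one_lt_two).sum_le_tsum _ fun k _ => by positivity
  · intro ω t ht
    obtain ⟨ht1, htN⟩ := Finset.mem_Icc.1 ht
    let k := Nat.sqrt t
    have hk1 : 1 ≤ k := Nat.sqrt_pos.2 ht1
    have hkt : k ^ 2 ≤ t := Nat.sqrt_le' t
    have htk : t ≤ k ^ 2 + 2 * k := by
      have : t < (k + 1) ^ 2 := Nat.lt_succ_sqrt' t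
      nlinarith
    have hkpos : (0 : ℝ) < k := by exact_mod_cast hk1
    have hkA : k ∈ A := Finset.mem_filter.2
      ⟨Finset.mem_Icc.2 ⟨hk1, (Nat.sqrt_le_self t).trans htN⟩, hkt.trans htN⟩
    have hqQ : q k ω ≤ Q ω := Finset.single_le_sum (fun k _ => hq0 k ω) hkA
    let D := ∑ s ∈ Finset.Ioc (k ^ 2) t, y s ω
    have hsub : Finset.Ioc (k ^ 2) t ⊆ B k :=
      Finset.Ioc_subset_Ioc_right (le_min htk htN)
    have hS : S t ω = S (k ^ 2) ω + D := by
      simp only [S, D]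
      have := Finset.sum_Ioc_consecutive (fun s => y s ω) (Nat.zero_le (k ^ 2)) hkt
      exact this.symm
    have hD : D ^ 2 ≤ 2 * k * ∑ s ∈ B k, y s ω ^ 2 := by
      calc D ^ 2 ≤ (Finset.Ioc (k ^ 2) t).card * ∑ s ∈ Finset.Ioc (k ^ 2) t, y s ω ^ 2 :=
            sq_sum_le_card_mul_sum_sq
        _ ≤ 2 * k * ∑ s ∈ B k, y s ω ^ 2 := by
            have h1 : ∑ s ∈ Finset.Ioc (k ^ 2) t, y s ω ^ 2 ≤ ∑ s ∈ B k, y s ω ^ 2 :=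
              Finset.sum_le_sum_of_subset_of_nonneg hsub fun s _ _ => sq_nonneg _
            have h2 : ((Finset.Ioc (k ^ 2) t).card : ℝ) ≤ 2 * k := by
              have : (Finset.Ioc (k ^ 2) t).card ≤ 2 * k := by
                rw [Nat.card_Ioc]; omega
              exact_mod_cast this
            exact mul_le_mul h2 h1 (Finset.sum_nonneg fun s _ => sq_nonneg _) (by positivity)
    have hbound : S t ω ^ 2 ≤ (k : ℝ) ^ 4 * q k ω := by
      simp only [q]
      rw [mul_div_cancel₀ _ (by positivity), hS]
      nlinarith [sq_nonneg (S (k ^ 2) ω - D)]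
    have hkt' : (k : ℝ) ^ 4 ≤ (t : ℝ) ^ 2 := by
      have : ((k : ℝ) ^ 2) ≤ t := by exact_mod_cast hkt
      calc (k : ℝ) ^ 4 = ((k : ℝ) ^ 2) ^ 2 := by ring
        _ ≤ _ := by gcongr
    have : S t ω ^ 2 ≤ (t * √(Q ω)) ^ 2 := by
      rw [mul_pow, Real.sq_sqrt (hQ0 ω)]
      exact hbound.trans (mul_le_mul hkt' hqQ (hq0 k ω) (by positivity))
    exact abs_le_of_sq_le_sq this (by positivity)

namespace LinearSecondMoment

variable {y : ℕ → Ω → ℝ} {C : ℝ}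

/-- Means over initial and final stretches of `1, …, T` are bounded in probability, uniformly in
the length of the stretch. -/
lemma exists_boundedInProb_means [IsFiniteMeasure P] (h : LinearSecondMoment P y C) :
    ∃ Y : ℕ → Ω → ℝ, BoundedInProb P Y ∧ (∀ T ω, 0 ≤ Y T ω) ∧
      ∀ T ω, ∀ t ∈ Finset.Icc 1 T, |∑ s ∈ Finset.Icc 1 t, y s ω| ≤ t * Y T ω ∧
        |∑ s ∈ Finset.Icc (T - t + 1) T, y s ω| ≤ t * Y T ω := by
  -- `Y₁` dominates the means of initial stretches, `Y₂` those of the reversed sequence, that is, of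
  -- final stretches.
  choose Y₁ i₁ e₁ n₁ b₁ using fun N => exists_dominating_running_mean h.nonneg (N := N) h.memLp
    fun F _ => h.integral_sq_le F
  choose Y₂ i₂ e₂ n₂ b₂ using fun N => exists_dominating_running_mean h.nonneg (N := N)
    (fun t => h.memLp (N + 1 - t)) h.integral_sq_reversed_le
  refine ⟨fun T ω => Y₁ T ω + Y₂ T ω,
    (BoundedInProb.of_integral_sq_le (.of_forall fun T => ⟨i₁ T, e₁ T⟩)).add
      (.of_integral_sq_le (.of_forall fun T => ⟨i₂ T, e₂ T⟩)),
    fun T ω => add_nonneg (n₁ T ω) (n₂ T ω), fun T ω t ht => ⟨?_, ?_⟩⟩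
  · refine (b₁ T ω t ht).trans ?_
    gcongr
    linarith [n₂ T ω]
  · have h3 : ∑ s ∈ Finset.Icc (T - t + 1) T, y s ω
        = ∑ s ∈ Finset.Icc 1 t, y (T + 1 - s) ω := by
      have ht' := Finset.mem_Icc.1 ht
      refine Finset.sum_nbij' (fun s => T + 1 - s) (fun s => T + 1 - s) ?_ ?_ ?_ ?_ ?_
      all_goals
        intro s hs
        simp only [Finset.mem_Icc] at hs ⊢
      · omega
      · omega
      · omega
      · omega
      · congr 1
        omega
    rw [h3]
    refine (b₂ T ω t ht).trans ?_
    gcongr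
    linarith [n₁ T ω]

lemma boundedInProb_sum_div_sqrt [IsFiniteMeasure P] (h : LinearSecondMoment P y C) :
    BoundedInProb P fun T ω => (∑ s ∈ Finset.Icc 1 T, y s ω) / √T := by
  refine BoundedInProb.of_integral_sq_le (C := C) ?_
  filter_upwards [eventually_gt_atTop 0] with T hT
  have hT' : (0 : ℝ) < T := by exact_mod_cast hT
  simp_rw [div_pow, Real.sq_sqrt hT'.le]
  refine ⟨(memLp_sum h.memLp _).integrable_sq.div_const _, ?_⟩
  rw [integral_div, div_le_iff₀ hT']
  simpa using h.integral_sq_le (Finset.Icc 1 T)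

end LinearSecondMoment

/-- Products of a second-order bounded sequence with an independent sequence with decaying
correlations. -/
lemma exists_linearSecondMoment_mul {y z : ℕ → Ω → ℝ}
    (hind : IndepFun (fun ω (t : ℕ) => y t ω) (fun ω (t : ℕ) => z t ω) P)
    (hy : ∀ t, MemLp (y t) 2 P) (hz : ∀ t, MemLp (z t) 2 P) {M c ζ : ℝ}
    (hM : ∀ t s, |∫ ω, y t ω * y s ω ∂P| ≤ M) (hc : 0 ≤ c) (hζ : 1 < ζ)
    (h : ∀ t s : ℕ, |∫ ω, z t ω * z s ω ∂P| ≤ c * (|(t : ℝ) - (s : ℝ)| + 1) ^ (-ζ)) :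
    ∃ C, LinearSecondMoment P (fun t ω => y t ω * z t ω) C := by
  have hM0 : 0 ≤ M := (abs_nonneg _).trans (hM 0 0)
  have hind2 : ∀ t, IndepFun (y t) (z t) P := fun t =>
    hind.comp (measurable_pi_apply t) (measurable_pi_apply t)
  refine exists_linearSecondMoment (c := M * c) (ζ := ζ) (fun t => ?_) (by positivity) hζ ?_
  · refine (memLp_two_iff_integrable_sq (f := fun ω => y t ω * z t ω)
      ((hy t).aestronglyMeasurable.mul (hz t).aestronglyMeasurable)).2 ?_
    simp_rw [mul_pow]
    exact ((hind2 t).comp (measurable_id.pow_const 2) (measurable_id.pow_const 2)).integrable_mul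
      (hy t).integrable_sq (hz t).integrable_sq
  · intro t s
    have h1 : IndepFun (fun ω => y t ω * y s ω) (fun ω => z t ω * z s ω) P :=
      hind.comp (φ := fun f : ℕ → ℝ => f t * f s) (ψ := fun f : ℕ → ℝ => f t * f s)
        -- Independence of the whole sequences is what separates the products at two different
        -- times.
        (by fun_prop) (by fun_prop)
    have h2 : ∫ ω, y t ω * z t ω * (y s ω * z s ω) ∂P
        = (∫ ω, y t ω * y s ω ∂P) * ∫ ω, z t ω * z s ω ∂P := by
      rw [← h1.integral_fun_mul_eq_mul_integral
        ((hy t).aestronglyMeasurable.mul (hy s).aestronglyMeasurable)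
        ((hz t).aestronglyMeasurable.mul (hz s).aestronglyMeasurable)]
      congr 1
      ext ω
      ring
    rw [h2, abs_mul, mul_assoc]
    exact mul_le_mul (hM t s) (h t s) (abs_nonneg _) hM0

end SecondMoments

/-! ### Mean ergodic theorems in `L²` and `L¹`. -/

section MeanErgodic

variable {α : Type*} [MeasurableSpace α] {μ : Measure α} {θ : α → α}

lemma MeasureTheory.MeasurePreserving.integral_birkhoffAverage (h : MeasurePreserving θ μ μ)
    {f : α → ℝ} (hf : Integrable f μ) {n : ℕ} (hn : n ≠ 0) :
    ∫ a, birkhoffAverage ℝ θ f n a ∂μ = ∫ a, f a ∂μ := by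
  have h1 : ∀ k, ∫ a, f (θ^[k] a) ∂μ = ∫ a, f a ∂μ := fun k => by
    have hk := h.iterate k
    rw [← integral_map hk.measurable.aemeasurable (by rw [hk.map_eq]; exact hf.aestronglyMeasurable),
      hk.map_eq]
  have h2 : ∀ k, Integrable (fun a => f (θ^[k] a)) μ := fun k =>
    (h.iterate k).integrable_comp_of_integrable hf
  simp only [birkhoffAverage, birkhoffSum, smul_eq_mul]
  rw [integral_const_mul, integral_finsetSum _ fun k _ => h2 k]
  simp only [h1, Finset.sum_const, Finset.card_range, nsmul_eq_mul]
  field_simp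

/-- The mean ergodic theorem in `L²`. -/
lemma Ergodic.tendsto_eLpNorm_two_birkhoffAverage [IsProbabilityMeasure μ] (h : Ergodic θ μ)
    {f : α → ℝ} (hf : MemLp f 2 μ) :
    Tendsto (fun n => eLpNorm (fun a => birkhoffAverage ℝ θ f n a - ∫ b, f b ∂μ) 2 μ)
      atTop (𝓝 0) := by
  have hθ := h.toMeasurePreserving
  let U : Lp ℝ 2 μ →L[ℝ] Lp ℝ 2 μ :=
    (Lp.compMeasurePreservingₗᵢ ℝ θ hθ).toContinuousLinearMap
  have hU : ‖U‖ ≤ 1 := LinearIsometry.norm_toContinuousLinearMap_le _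
  -- Von Neumann's theorem for the Koopman operator: averages converge to the projection onto the
  -- fixed vectors.
  have hvn := U.tendsto_birkhoffAverage_orthogonalProjection hU (hf.toLp f)
  set p : Lp ℝ 2 μ := ((U.eqLocus (1 : Lp ℝ 2 μ →L[ℝ] Lp ℝ 2 μ)).orthogonalProjectionOnto
    (hf.toLp f) : Lp ℝ 2 μ) with hp
  have hpfix : U p = p := ((U.eqLocus (1 : Lp ℝ 2 μ →L[ℝ] Lp ℝ 2 μ)).orthogonalProjectionOnto
    (hf.toLp f)).2
  -- The limit is invariant, hence almost everywhere constant by ergodicity.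
  obtain ⟨c, hc⟩ : ∃ c, (p : α → ℝ) =ᵐ[μ] Function.const α c := by
    refine h.ae_eq_const_of_ae_eq_comp_ae (Lp.aestronglyMeasurable p) ?_
    have h1 := Lp.coeFn_compMeasurePreserving p hθ
    have h2 : (Lp.compMeasurePreserving θ hθ p : Lp ℝ 2 μ) = p := hpfix
    rw [h2] at h1
    exact h1.symm
  have hmem : ∀ n, MemLp (birkhoffAverage ℝ θ f n) 2 μ := by
    intro n
    have : MemLp (fun a => (n : ℝ)⁻¹ * ∑ k ∈ Finset.range n, f (θ^[k] a)) 2 μ :=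
      (memLp_finsetSum _ fun k _ => hf.comp_measurePreserving (hθ.iterate k)).const_mul _
    exact this
  have hiter : ∀ k, (U^[k]) (hf.toLp f) =
      (hf.comp_measurePreserving (hθ.iterate k)).toLp (f ∘ θ^[k]) := by
    intro k
    have h1 := Lp.compMeasurePreserving_iterate (E := ℝ) (p := 2) hθ k
    have h2 : (U^[k]) = (Lp.compMeasurePreserving θ hθ : Lp ℝ 2 μ → Lp ℝ 2 μ)^[k] := rfl
    rw [h2, ← Lp.toLp_compMeasurePreserving hf (hθ.iterate k), ← h1]
  have hcoe : ∀ n, ((birkhoffAverage ℝ U _root_.id n (hf.toLp f) : Lp ℝ 2 μ) : α → ℝ)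
      =ᵐ[μ] birkhoffAverage ℝ θ f n := by
    intro n
    have h1 : birkhoffAverage ℝ U _root_.id n (hf.toLp f) = (hmem n).toLp _ := by
      have h3 : ∀ s : Finset ℕ, ∑ k ∈ s, (hf.comp_measurePreserving (hθ.iterate k)).toLp (f ∘ θ^[k])
          = (memLp_finsetSum' s fun k _ => hf.comp_measurePreserving (hθ.iterate k)).toLp
            (∑ k ∈ s, f ∘ θ^[k]) := by
        classical
        intro s
        induction s using Finset.induction_on with
        | empty => simp
        | insert i s hi ih =>
          simp only [Finset.sum_insert hi, ih]
          rfl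
      simp only [birkhoffAverage, birkhoffSum, _root_.id]
      simp_rw [hiter]
      rw [h3, ← MemLp.toLp_const_smul]
      congr 1
      ext a
      simp [birkhoffAverage, birkhoffSum]
    rw [h1]
    exact (hmem n).coeFn_toLp
  have hconv : Tendsto (fun n => eLpNorm (fun a => birkhoffAverage ℝ θ f n a - c) 2 μ)
      atTop (𝓝 0) := by
    have h1 := (Lp.tendsto_Lp_iff_tendsto_eLpNorm' _ _).1 hvn
    refine h1.congr fun n => eLpNorm_congr_ae ?_
    filter_upwards [hcoe n, hc] with a h2 h3
    simp only [Pi.sub_apply, h2]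
    rw [h3, Function.const]
  -- Averaging preserves the integral, and the integral is continuous for `L¹` convergence; this
  -- identifies the constant.
  have hcint : c = ∫ b, f b ∂μ := by
    have hint : ∀ n, Integrable (birkhoffAverage ℝ θ f n) μ := fun n =>
      (hmem n).integrable one_le_two
    have h0 : Tendsto (fun n => eLpNorm (fun a => birkhoffAverage ℝ θ f n a - c) 1 μ)
        atTop (𝓝 0) := by
      refine tendsto_of_tendsto_of_tendsto_of_le_of_le tendsto_const_nhds hconv
        (fun _ => zero_le) fun n => ?_
      exact eLpNorm_le_eLpNorm_of_exponent_le one_le_two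
        ((hmem n).aestronglyMeasurable.sub aestronglyMeasurable_const)
    have h1 : Tendsto (fun n => ∫ a, birkhoffAverage ℝ θ f n a ∂μ) atTop (𝓝 (∫ _, c ∂μ)) :=
      tendsto_integral_of_L1' _ aestronglyMeasurable_const (.of_forall hint) h0
    have h2 : Tendsto (fun n => ∫ a, birkhoffAverage ℝ θ f n a ∂μ) atTop (𝓝 (∫ b, f b ∂μ)) := by
      refine tendsto_const_nhds.congr' ?_
      filter_upwards [eventually_ne_atTop 0] with n hn
      exact (hθ.integral_birkhoffAverage (hf.integrable one_le_two) hn).symm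
    have := tendsto_nhds_unique h1 h2
    simpa using this
  rwa [hcint] at hconv

/-- The mean ergodic theorem in `L¹`. -/
lemma Ergodic.tendsto_eLpNorm_one_birkhoffAverage [IsProbabilityMeasure μ] (h : Ergodic θ μ)
    {f : α → ℝ} (hf : Integrable f μ) :
    Tendsto (fun n => eLpNorm (fun a => birkhoffAverage ℝ θ f n a - ∫ b, f b ∂μ) 1 μ)
      atTop (𝓝 0) := by
  have hθ := h.toMeasurePreserving
  have havg : ∀ {r : α → ℝ}, Integrable r μ → ∀ n, Integrable (birkhoffAverage ℝ θ r n) μ := by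
    intro r hr n
    have : Integrable (fun a => (n : ℝ)⁻¹ * ∑ k ∈ Finset.range n, r (θ^[k] a)) μ :=
      (integrable_finsetSum _ fun k _ =>
        (hθ.iterate k).integrable_comp_of_integrable hr).const_mul _
    exact this
  -- Averaging is an `L¹` contraction, which controls the approximation error uniformly in `n`.
  have hcontr : ∀ {r : α → ℝ}, Integrable r μ → ∀ n,
      eLpNorm (birkhoffAverage ℝ θ r n) 1 μ ≤ eLpNorm r 1 μ := by
    intro r hr n
    rcases eq_or_ne n 0 with rfl | hn
    · simp [birkhoffAverage_zero']
    have h1 : eLpNorm (∑ k ∈ Finset.range n, r ∘ θ^[k]) 1 μ ≤ n * eLpNorm r 1 μ := by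
      refine (eLpNorm_sum_le (fun k _ =>
        hr.aestronglyMeasurable.comp_measurePreserving (hθ.iterate k)) le_rfl).trans ?_
      simp_rw [eLpNorm_comp_measurePreserving hr.aestronglyMeasurable (hθ.iterate _)]
      simp
    have h2 : birkhoffAverage ℝ θ r n = (n : ℝ)⁻¹ • ∑ k ∈ Finset.range n, r ∘ θ^[k] := by
      ext a
      simp [birkhoffAverage, birkhoffSum]
    rw [h2, eLpNorm_const_smul]
    refine (mul_le_mul_right h1 _).trans ?_
    rw [← mul_assoc, Real.enorm_eq_ofReal (by positivity),
      ENNReal.ofReal_inv_of_pos (by positivity), ENNReal.ofReal_natCast,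
      ENNReal.inv_mul_cancel (by exact_mod_cast hn) (by simp), one_mul]
  rw [ENNReal.tendsto_nhds_zero]
  intro ε hε
  -- A simple function close to `f` in `L¹` lies in `L²`. The budget is `ε / 2` for its averages and
  -- `ε / 4` each for the averages and the integral of `f - g`.
  obtain ⟨g, hg, hg2⟩ : ∃ g : α → ℝ, eLpNorm (f - g) 1 μ < ε / 2 / 2 ∧ MemLp g 2 μ := by
    obtain ⟨g, hg, -⟩ := (memLp_one_iff_integrable.2 hf).exists_simpleFunc_eLpNorm_sub_lt
      ENNReal.one_ne_top (ENNReal.half_pos (ENNReal.half_pos hε.ne').ne').ne'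
    exact ⟨g, hg, g.memLp_of_isFiniteMeasure 2 μ⟩
  have hgi : Integrable g μ := hg2.integrable one_le_two
  have hr : Integrable (f - g) μ := hf.sub hgi
  have hε2 : (0 : ℝ≥0∞) < ε / 2 := ENNReal.half_pos hε.ne'
  filter_upwards [(ENNReal.tendsto_nhds_zero.1 (h.tendsto_eLpNorm_two_birkhoffAverage hg2)) _ hε2]
    with n hn
  have hsplit : (fun a => birkhoffAverage ℝ θ f n a - ∫ b, f b ∂μ)
      = (fun a => birkhoffAverage ℝ θ g n a - ∫ b, g b ∂μ) + (birkhoffAverage ℝ θ (f - g) n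
        + fun _ => ∫ b, (g b - f b) ∂μ) := by
    ext a
    rw [integral_sub hgi hf]
    simp only [Pi.add_apply, birkhoffAverage, birkhoffSum, Pi.sub_apply, Finset.sum_sub_distrib,
      smul_eq_mul]
    ring
  rw [hsplit]
  have mg : AEStronglyMeasurable (fun a => birkhoffAverage ℝ θ g n a - ∫ b, g b ∂μ) μ :=
    ((havg hgi n).sub (integrable_const _)).aestronglyMeasurable
  have hconst : eLpNorm (fun _ : α => ∫ b, (g b - f b) ∂μ) 1 μ ≤ ε / 2 / 2 := by
    rw [eLpNorm_const _ one_ne_zero (IsProbabilityMeasure.ne_zero μ)]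
    simp only [measure_univ, ENNReal.toReal_one, ne_eq, one_ne_zero, not_false_eq_true, div_self,
      ENNReal.one_rpow, mul_one]
    refine (enorm_integral_le_lintegral_enorm _).trans ?_
    rw [← eLpNorm_one_eq_lintegral_enorm]
    have : eLpNorm (fun a => g a - f a) 1 μ = eLpNorm (f - g) 1 μ := eLpNorm_sub_comm _ _ _ _
    rw [this]
    exact hg.le
  calc _ ≤ eLpNorm (fun a => birkhoffAverage ℝ θ g n a - ∫ b, g b ∂μ) 1 μ +
        eLpNorm (birkhoffAverage ℝ θ (f - g) n + fun _ => ∫ b, (g b - f b) ∂μ) 1 μ :=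
        eLpNorm_add_le mg ((havg hr n).add (integrable_const _)).aestronglyMeasurable le_rfl
    _ ≤ ε / 2 + (ε / 2 / 2 + ε / 2 / 2) := by
        gcongr
        · exact (eLpNorm_le_eLpNorm_of_exponent_le one_le_two mg).trans hn
        · refine (eLpNorm_add_le (havg hr n).aestronglyMeasurable
            aestronglyMeasurable_const le_rfl).trans ?_
          gcongr
          exact (hcontr hr n).trans hg.le
    _ = ε := by rw [ENNReal.add_halves, ENNReal.add_halves]

lemma Ergodic.tendstoInMeasure_birkhoffAverage [IsProbabilityMeasure μ] (h : Ergodic θ μ)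
    {f : α → ℝ} (hf : Integrable f μ) :
    TendstoInMeasure μ (fun n => birkhoffAverage ℝ θ f n) atTop fun _ => ∫ b, f b ∂μ := by
  refine tendstoInMeasure_of_tendsto_eLpNorm one_ne_zero (fun n => ?_) aestronglyMeasurable_const
    (h.tendsto_eLpNorm_one_birkhoffAverage hf)
  have : AEStronglyMeasurable (fun a => (n : ℝ)⁻¹ * ∑ k ∈ Finset.range n, f (θ^[k] a)) μ :=
    ((integrable_finsetSum _ fun k _ =>
      (h.toMeasurePreserving.iterate k).integrable_comp_of_integrable hf).const_mul
        _).aestronglyMeasurable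
  exact this

end MeanErgodic

/-! ### Stationary ergodic regressors: law of large numbers and correlations. -/

namespace IsStationaryErgodic

lemma iterate_shift {E : Type*} (f : ℕ → E) (k n : ℕ) :
    (fun (f : ℕ → E) (n : ℕ) => f (n + 1))^[k] f n = f (n + k) := by
  induction k generalizing f with
  | zero => rfl
  | succ k ih =>
    rw [Function.iterate_succ_apply, ih]
    exact congrArg f (by omega)

variable {Ω E : Type*} [MeasurableSpace Ω] [MeasurableSpace E] {P : Measure Ω}
  {x : ℕ → Ω → E}

lemma identDistrib_shift (h : IsStationaryErgodic P x) (hx : ∀ t, Measurable (x t)) (s : ℕ) :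
    IdentDistrib (fun ω n => x (n + s) ω) (fun ω n => x n ω) P P := by
  have hm : Measurable fun ω (n : ℕ) => x n ω := measurable_pi_lambda _ hx
  refine ⟨(measurable_pi_lambda _ fun n => hx (n + s)).aemeasurable, hm.aemeasurable, ?_⟩
  have h1 := (h.toMeasurePreserving.iterate s)
  rw [← h1.map_eq, Measure.map_map h1.measurable hm]
  congr 1
  ext ω n
  simp [iterate_shift]

/-- The weak law of large numbers for stationary ergodic sequences. -/
lemma tendstoInMeasure_average [IsProbabilityMeasure P] (h : IsStationaryErgodic P x)
    (hx : ∀ t, Measurable (x t)) {g : E → ℝ} (hg : Measurable g)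
    (hint : Integrable (fun ω => g (x 0 ω)) P) :
    TendstoInMeasure P (fun (T : ℕ) ω => (T : ℝ)⁻¹ * ∑ s ∈ Finset.Icc 1 T, g (x s ω)) atTop
      fun _ => ∫ ω, g (x 0 ω) ∂P := by
  have hm : Measurable fun ω (n : ℕ) => x n ω := measurable_pi_lambda _ hx
  have := Measure.isProbabilityMeasure_map (μ := P) hm.aemeasurable
  have hid := (h.identDistrib_shift hx 1).comp (u := fun f : ℕ → E => g (f 0)) (by fun_prop)
  -- Birkhoff sums start at time `0` but the sample starts at time `1`, so the observable reads
  -- coordinate `1`.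
  have hφ : Measurable fun f : ℕ → E => g (f 1) := by fun_prop
  have hint1 : Integrable (fun ω => g (x 1 ω)) P := by
    have := hid.integrable_iff.2 hint
    simpa [Function.comp_def] using this
  have hmean : ∫ f, g (f 1) ∂(P.map fun ω (n : ℕ) => x n ω) = ∫ ω, g (x 0 ω) ∂P := by
    rw [integral_map hm.aemeasurable hφ.aestronglyMeasurable]
    simpa [Function.comp_def] using hid.integral_eq
  have hL := Ergodic.tendstoInMeasure_birkhoffAverage h
    (f := fun f : ℕ → E => g (f 1))
    ((integrable_map_measure hφ.aestronglyMeasurable hm.aemeasurable).2 hint1)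
  rw [hmean] at hL
  intro ε hε
  refine tendsto_of_tendsto_of_tendsto_of_le_of_le tendsto_const_nhds (hL ε hε)
    (fun _ => zero_le) fun T => ?_
  -- Only an upper bound is needed, so the event need not be shown measurable.
  refine le_trans (le_of_eq ?_) (Measure.le_map_apply hm.aemeasurable _)
  congr 1
  ext ω
  simp only [Set.mem_ofPred_eq, Set.mem_preimage, birkhoffAverage, birkhoffSum, iterate_shift,
    smul_eq_mul]
  have hsum : ∑ s ∈ Finset.Icc 1 T, g (x s ω) = ∑ k ∈ Finset.range T, g (x (1 + k) ω) := by
    simp_rw [add_comm 1]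
    rw [Finset.range_eq_Ico,
      Finset.sum_Ico_add' (fun s => g (x s ω)) 0 T 1]
    rfl
  rw [hsum]

end IsStationaryErgodic

namespace IsStationaryErgodic

variable {Ω : Type*} [MeasurableSpace Ω] {P : Measure Ω} {d : ℕ} {x : ℕ → Ω → Fin d → ℝ}

lemma integral_comp_shift (h : IsStationaryErgodic P x) (hx : ∀ t, Measurable (x t)) (s : ℕ)
    {φ : (ℕ → Fin d → ℝ) → ℝ} (hφ : Measurable φ) :
    ∫ ω, φ (fun n => x (n + s) ω) ∂P = ∫ ω, φ (fun n => x n ω) ∂P :=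
  ((h.identDistrib_shift hx s).comp hφ).integral_eq

lemma integral_coord (h : IsStationaryErgodic P x) (hx : ∀ t, Measurable (x t)) (s : ℕ)
    (i : Fin d) : ∫ ω, x s ω i ∂P = ∫ ω, x 0 ω i ∂P := by
  simpa using h.integral_comp_shift hx s (φ := fun f => f 0 i) (by fun_prop)

/-- The inequality `2|ab| ≤ a² + b²`, after which stationarity makes both second moments equal to
that at time `0`. -/
lemma abs_integral_mul_le (h : IsStationaryErgodic P x) (hx : ∀ t, Measurable (x t))
    (hx_sq : ∀ t i, MemLp (fun ω => x t ω i) 2 P) (i : Fin d) (s t : ℕ) :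
    |∫ ω, x s ω i * x t ω i ∂P| ≤ ∫ ω, x 0 ω i ^ 2 ∂P := by
  have e : ∀ s, ∫ ω, x s ω i ^ 2 ∂P = ∫ ω, x 0 ω i ^ 2 ∂P := fun s => by
    simpa using h.integral_comp_shift hx s (φ := fun f => f 0 i ^ 2) (by fun_prop)
  have hs := (hx_sq s i).integrable_sq
  have ht := (hx_sq t i).integrable_sq
  calc |∫ ω, x s ω i * x t ω i ∂P| ≤ ∫ ω, |x s ω i * x t ω i| ∂P := abs_integral_le_integral_abs
    _ ≤ ∫ ω, (x s ω i ^ 2 + x t ω i ^ 2) / 2 ∂P := by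
        refine integral_mono ((hx_sq s i).integrable_mul (hx_sq t i)).abs
          ((hs.add ht).div_const 2) fun ω => ?_
        simp only
        rw [abs_le]
        constructor <;> nlinarith [sq_nonneg (x s ω i - x t ω i), sq_nonneg (x s ω i + x t ω i)]
    _ = ∫ ω, x 0 ω i ^ 2 ∂P := by
        rw [integral_div, integral_add hs ht, e s, e t]
        ring

/-- Stationarity moves the earlier of two times to `0`, where the covariance bound is assumed. -/
lemma exists_linearSecondMoment_centered [IsProbabilityMeasure P] (h : IsStationaryErgodic P x)
    (hx : ∀ t, Measurable (x t)) (hx_sq : ∀ t i, MemLp (fun ω => x t ω i) 2 P) {c ζ : ℝ}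
    (hc : 0 ≤ c) (hζ : 1 < ζ) (i : Fin d)
    (hcov : ∀ t : ℕ, |covariance (fun ω => x 0 ω i) (fun ω => x t ω i) P|
      ≤ c * ((t : ℝ) + 1) ^ (-ζ)) :
    ∃ C, LinearSecondMoment P (fun t ω => x t ω i - ∫ ω', x 0 ω' i ∂P) C := by
  set m := ∫ ω', x 0 ω' i ∂P
  have key : ∀ s r : ℕ, ∫ ω, (x s ω i - m) * (x (r + s) ω i - m) ∂P
      = covariance (fun ω => x 0 ω i) (fun ω => x r ω i) P := by
    intro s r
    have h1 := h.integral_comp_shift hx s (φ := fun f => (f 0 i - m) * (f r i - m)) (by fun_prop)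
    simp only [zero_add] at h1
    rw [h1, covariance, h.integral_coord hx r i]
  refine exists_linearSecondMoment (fun t => (hx_sq t i).sub (memLp_const m)) hc hζ fun t s => ?_
  rcases le_total s t with hst | hst
  · obtain ⟨r, rfl⟩ := Nat.exists_eq_add_of_le' hst
    simp_rw [mul_comm (x (r + s) _ i - m)]
    rw [key]
    refine (hcov r).trans (le_of_eq ?_)
    push_cast
    rw [add_sub_cancel_right, abs_of_nonneg (Nat.cast_nonneg r)]
  · obtain ⟨r, rfl⟩ := Nat.exists_eq_add_of_le' hst
    rw [key]
    refine (hcov r).trans (le_of_eq ?_)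
    push_cast
    rw [abs_sub_comm, add_sub_cancel_right, abs_of_nonneg (Nat.cast_nonneg r)]

/-- The normalized Gram matrix `Zᵀ Z / T` tends to the second moment matrix in probability. -/
lemma tendstoInMeasure_gram [IsProbabilityMeasure P] (h : IsStationaryErgodic P x)
    (hx : ∀ t, Measurable (x t)) (hx_sq : ∀ t i, MemLp (fun ω => x t ω i) 2 P) (i j : Fin d) :
    TendstoInMeasure P (fun (T : ℕ) ω => (T : ℝ)⁻¹ *
      ((designMatrix (fun t => x t ω) T)ᵀ * designMatrix (fun t => x t ω) T) i j) atTop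
      fun _ => secondMomentMatrix P x i j := by
  have := h.tendstoInMeasure_average hx (g := fun v => v i * v j) (by fun_prop)
    ((hx_sq 0 i).integrable_mul (hx_sq 0 j))
  convert this using 4 with T ω
  · rw [Matrix.mul_apply, ← Finset.sum_coe_sort (Finset.Icc 1 T)]
    rfl
  · rfl

end IsStationaryErgodic

/-! ### Stability of matrix inversion and algebra of the least squares estimator. -/

/-- Determinant and inverse are continuous at an invertible matrix. The bound `K` is any number
above all entries of `|C⁻¹|`; their sum plus one will do. -/
lemma Matrix.exists_inv_bound {d : ℕ} (C : Matrix (Fin d) (Fin d) ℝ) (hC : IsUnit C.det) :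
    ∃ η K : ℝ, 0 < η ∧ ∀ A : Matrix (Fin d) (Fin d) ℝ, (∀ i j, |A i j - C i j| < η) →
      IsUnit A.det ∧ ∀ i j, |A⁻¹ i j| ≤ K := by
  have hdet : ContinuousAt (fun A : Matrix (Fin d) (Fin d) ℝ => A.det) C :=
    (continuous_id.matrix_det).continuousAt
  have hinv : ContinuousAt (fun A : Matrix (Fin d) (Fin d) ℝ => fun i j => A⁻¹ i j) C := by
    simp only [Matrix.inv_def, Ring.inverse_eq_inv', Matrix.smul_apply, smul_eq_mul]
    refine continuousAt_pi.2 fun i => continuousAt_pi.2 fun j => ?_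
    exact (hdet.inv₀ hC.ne_zero).mul
      ((continuous_id.matrix_adjugate).matrix_elem i j).continuousAt
  have h1 : ∀ᶠ A in 𝓝 C, A.det ≠ 0 := hdet.eventually_ne hC.ne_zero
  have h2 : ∀ᶠ A in 𝓝 C, ∀ i j, |A⁻¹ i j| ≤ ∑ k, ∑ l, |C⁻¹ k l| + 1 := by
    rw [eventually_all]
    intro i
    rw [eventually_all]
    intro j
    have h3 : ContinuousAt (fun A : Matrix (Fin d) (Fin d) ℝ => |A⁻¹ i j|) C :=
      (continuousAt_pi.1 (continuousAt_pi.1 hinv i) j).abs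
    have h4 : |C⁻¹ i j| < ∑ k, ∑ l, |C⁻¹ k l| + 1 := by
      have h5 : |C⁻¹ i j| ≤ ∑ l, |C⁻¹ i l| :=
        Finset.single_le_sum (f := fun l => |C⁻¹ i l|) (fun _ _ => abs_nonneg _)
          (Finset.mem_univ j)
      have h6 : ∑ l, |C⁻¹ i l| ≤ ∑ k, ∑ l, |C⁻¹ k l| :=
        Finset.single_le_sum (f := fun k => ∑ l, |C⁻¹ k l|)
          (fun _ _ => Finset.sum_nonneg fun _ _ => abs_nonneg _) (Finset.mem_univ i)
      linarith
    filter_upwards [h3.eventually_lt continuousAt_const h4] with A hA using hA.le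
  have h7 := h1.and h2
  -- Viewed as functions of two indices, matrices carry the sup metric, whose balls are described
  -- entrywise.
  have h8 : ∀ᶠ A : Fin d → Fin d → ℝ in 𝓝 (C : Fin d → Fin d → ℝ),
      (Matrix.of A).det ≠ 0 ∧ ∀ i j, |(Matrix.of A)⁻¹ i j| ≤ ∑ k, ∑ l, |C⁻¹ k l| + 1 := h7
  obtain ⟨η, hη, hball⟩ := Metric.eventually_nhds_iff.1 h8
  refine ⟨η, ∑ k, ∑ l, |C⁻¹ k l| + 1, hη, fun A hA => ?_⟩
  have h9 := hball (y := A) ((dist_pi_lt_iff hη).2 fun i => (dist_pi_lt_iff hη).2 fun j => by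
    rw [Real.dist_eq]; exact hA i j)
  exact ⟨isUnit_iff_ne_zero.2 h9.1, h9.2⟩

section Estimator

variable {d : ℕ}

lemma designMatrix_transpose_mulVec (x : ℕ → Fin d → ℝ) (T : ℕ) (y : ℕ → ℝ) (j : Fin d) :
    ((designMatrix x T)ᵀ *ᵥ fun t : Finset.Icc 1 T => y t) j
      = ∑ s ∈ Finset.Icc 1 T, x s j * y s := by
  rw [← Finset.sum_coe_sort (Finset.Icc 1 T)]
  rfl

/-- The estimation error of least squares in the linear model. -/
lemma olsEstimator_eq_add (x : ℕ → Fin d → ℝ) (X e : ℕ → ℝ) (b : Fin d → ℝ) {T : ℕ}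
    (hX : ∀ t ∈ Finset.Icc 1 T, X t = x t ⬝ᵥ b + e t)
    (hdet : IsUnit ((designMatrix x T)ᵀ * designMatrix x T).det) :
    olsEstimator x X T = b + olsEstimator x e T := by
  have h1 : (fun t : Finset.Icc 1 T => X t)
      = designMatrix x T *ᵥ b + fun t : Finset.Icc 1 T => e t := by
    ext t
    exact hX t t.2
  rw [olsEstimator, h1, Matrix.mulVec_add, Matrix.mulVec_add, Matrix.mulVec_mulVec,
    Matrix.mulVec_mulVec, Matrix.mul_assoc, Matrix.nonsing_inv_mul _ hdet, Matrix.one_mulVec]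
  rfl

/-- Distributing the factor `T` gives the inverse of the normalized Gram matrix, which stays
bounded, times an average that tends to be small. -/
lemma abs_olsEstimator_le (x : ℕ → Fin d → ℝ) (e : ℕ → ℝ) {T : ℕ} (hT : T ≠ 0) {K : ℝ}
    (hA : ∀ i j, |((T : ℝ)⁻¹ • ((designMatrix x T)ᵀ * designMatrix x T))⁻¹ i j| ≤ K)
    (hdet : IsUnit ((designMatrix x T)ᵀ * designMatrix x T).det) (i : Fin d) :
    |olsEstimator x e T i| ≤ K * ∑ j, |(T : ℝ)⁻¹ * ∑ s ∈ Finset.Icc 1 T, x s j * e s| := by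
  have hT' : (T : ℝ) ≠ 0 := by exact_mod_cast hT
  set G := (designMatrix x T)ᵀ * designMatrix x T with hG
  have hinv : ((T : ℝ)⁻¹ • G)⁻¹ = (T : ℝ) • G⁻¹ := by
    apply Matrix.inv_eq_left_inv
    rw [Matrix.smul_mul, Matrix.mul_smul, smul_smul, Matrix.nonsing_inv_mul _ hdet,
      mul_inv_cancel₀ hT', one_smul]
  have h1 : olsEstimator x e T i
      = ∑ j, ((T : ℝ)⁻¹ • G)⁻¹ i j * ((T : ℝ)⁻¹ * ∑ s ∈ Finset.Icc 1 T, x s j * e s) := by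
    rw [hinv]
    simp only [olsEstimator, Matrix.mulVec, dotProduct, ← hG, Matrix.smul_apply, smul_eq_mul]
    refine Finset.sum_congr rfl fun j _ => ?_
    have := designMatrix_transpose_mulVec x T e j
    simp only [Matrix.mulVec, dotProduct] at this
    rw [this]
    field_simp
  rw [h1, Finset.mul_sum]
  refine (Finset.abs_sum_le_sum_abs _ _).trans (Finset.sum_le_sum fun j _ => ?_)
  rw [abs_mul]
  exact mul_le_mul_of_nonneg_right (hA i j) (abs_nonneg _)

end Estimator

/-! ### Mean differences and their maxima over the two halves of the sample. -/

noncomputable section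

/-- The integers `t` with `τ ≤ t ≤ T / 2`. -/
def trimmedHalf (T : ℕ) (τ : ℝ) : Finset ℕ :=
  {t ∈ Finset.range (T + 1) | τ ≤ (t : ℝ) ∧ (t : ℝ) ≤ (T : ℝ) / 2}

lemma mem_trimmedHalf {T t : ℕ} {τ : ℝ} :
    t ∈ trimmedHalf T τ ↔ τ ≤ (t : ℝ) ∧ (t : ℝ) ≤ (T : ℝ) / 2 := by
  simp only [trimmedHalf, Finset.mem_filter, Finset.mem_range, and_iff_right_iff_imp]
  rintro ⟨-, h⟩
  have : (t : ℝ) ≤ T := h.trans (half_le_self (Nat.cast_nonneg T))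
  exact Nat.lt_succ_of_le (by exact_mod_cast this)

lemma trimmedHalf_subset {T : ℕ} {τ τ' : ℝ} (h : τ ≤ τ') :
    trimmedHalf T τ' ⊆ trimmedHalf T τ := fun _ ht =>
  mem_trimmedHalf.2 ⟨h.trans (mem_trimmedHalf.1 ht).1, (mem_trimmedHalf.1 ht).2⟩

/-- The maximum of `|m t|` over `τ ≤ t ≤ T / 2`, which is `0` if there is no such `t`. -/
def halfMax (m : ℕ → ℝ) (T : ℕ) (τ : ℝ) : ℝ :=
  ‖fun t : trimmedHalf T τ => m t‖

lemma halfMax_nonneg (m : ℕ → ℝ) (T : ℕ) (τ : ℝ) : 0 ≤ halfMax m T τ := norm_nonneg _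

lemma abs_le_halfMax (m : ℕ → ℝ) {T t : ℕ} {τ : ℝ} (ht : t ∈ trimmedHalf T τ) :
    |m t| ≤ halfMax m T τ :=
  norm_le_pi_norm (fun t : trimmedHalf T τ => m t) ⟨t, ht⟩

lemma halfMax_le {m : ℕ → ℝ} {T : ℕ} {τ R : ℝ} (hR : 0 ≤ R)
    (h : ∀ t ∈ trimmedHalf T τ, |m t| ≤ R) : halfMax m T τ ≤ R :=
  (pi_norm_le_iff_of_nonneg hR).2 fun t => h t t.2

lemma ofReal_halfMax_le {m : ℕ → ℝ} {T : ℕ} {τ : ℝ} {R : ℝ≥0∞}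
    (h : ∀ t ∈ trimmedHalf T τ, ENNReal.ofReal |m t| ≤ R) : ENNReal.ofReal (halfMax m T τ) ≤ R := by
  rcases eq_or_ne R ∞ with rfl | hR
  · exact le_top
  · rw [ENNReal.ofReal_le_iff_le_toReal hR]
    exact halfMax_le ENNReal.toReal_nonneg fun t ht =>
      (ENNReal.ofReal_le_iff_le_toReal hR).1 (h t ht)

/-- The mean over `1, …, t` minus the mean over `t + 1, …, T`. -/
def meanDifference (y : ℕ → ℝ) (T t : ℕ) : ℝ :=
  1 / (t : ℝ) * ∑ s ∈ Finset.Icc 1 t, y s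
    - 1 / ((T : ℝ) - (t : ℝ)) * ∑ s ∈ Finset.Icc (t + 1) T, y s

lemma meanDifference_sub (y z : ℕ → ℝ) (T t : ℕ) :
    meanDifference (fun s => y s - z s) T t = meanDifference y T t - meanDifference z T t := by
  simp only [meanDifference, Finset.sum_sub_distrib]
  ring

lemma meanDifference_sum {ι : Type*} (F : Finset ι) (c : ι → ℝ) (y : ι → ℕ → ℝ) (T t : ℕ) :
    meanDifference (fun s => ∑ i ∈ F, y i s * c i) T t
      = ∑ i ∈ F, meanDifference (y i) T t * c i := by
  simp only [meanDifference, sub_mul, Finset.sum_sub_distrib, Finset.mul_sum, Finset.sum_mul]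
  congr 1 <;> rw [Finset.sum_comm]
  all_goals exact Finset.sum_congr rfl fun _ _ => Finset.sum_congr rfl fun _ _ => by ring

/-- This permits regressors with nonzero mean: they may be centred at no cost. -/
lemma meanDifference_const (m : ℝ) {T t : ℕ} (h1 : 1 ≤ t) (hT : t < T) :
    meanDifference (fun _ => m) T t = 0 := by
  have h1' : (0 : ℝ) < t := by exact_mod_cast h1
  have h2' : (0 : ℝ) < (T : ℝ) - t := sub_pos.2 (by exact_mod_cast hT)
  simp only [meanDifference, Finset.sum_const, Nat.card_Icc, nsmul_eq_mul, Nat.add_sub_add_right]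
  rw [Nat.add_sub_cancel, Nat.cast_sub hT.le]
  field_simp
  simp

lemma meanDifference_congr {y z : ℕ → ℝ} {T t : ℕ} (ht : t ≤ T)
    (h : ∀ s ∈ Finset.Icc 1 T, y s = z s) : meanDifference y T t = meanDifference z T t := by
  rw [meanDifference, meanDifference, Finset.sum_congr rfl fun s hs => h s ?_,
    Finset.sum_congr (s₁ := Finset.Icc (t + 1) T) rfl fun s hs => h s ?_]
  · simp only [Finset.mem_Icc] at hs ⊢
    omega
  · simp only [Finset.mem_Icc] at hs ⊢
    omega

lemma finite_renyi_range (T : ℕ) (τ : ℝ) :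
    Finite {t : ℕ // τ ≤ (t : ℝ) ∧ (t : ℝ) ≤ (T : ℝ) - τ} := by
  refine Set.Finite.to_subtype (s := {t : ℕ | τ ≤ (t : ℝ) ∧ (t : ℝ) ≤ (T : ℝ) - τ}) ?_
  refine (Set.finite_Iic ⌊(T : ℝ) - τ⌋₊).subset fun t ht => Nat.le_floor ht.2

lemma renyiStatistic_nonneg (y : ℕ → ℝ) (T : ℕ) (τ : ℝ) : 0 ≤ renyiStatistic y T τ :=
  Real.iSup_nonneg fun _ => abs_nonneg _

lemma abs_meanDifference_le_renyiStatistic (y : ℕ → ℝ) {T t : ℕ} {τ : ℝ} (h1 : τ ≤ t)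
    (h2 : (t : ℝ) ≤ T - τ) : |meanDifference y T t| ≤ renyiStatistic y T τ := by
  have := finite_renyi_range T τ
  exact le_ciSup (f := fun t : {t : ℕ // τ ≤ (t : ℝ) ∧ (t : ℝ) ≤ (T : ℝ) - τ} =>
    |meanDifference y T t|) (Set.finite_range _).bddAbove ⟨t, h1, h2⟩

lemma renyiStatistic_le {y : ℕ → ℝ} {T : ℕ} {τ R : ℝ} (hR : 0 ≤ R)
    (h : ∀ t : ℕ, τ ≤ t → (t : ℝ) ≤ T - τ → |meanDifference y T t| ≤ R) :
    renyiStatistic y T τ ≤ R :=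
  Real.iSup_le (fun t => h t t.2.1 t.2.2) hR

/-- The Rényi statistic is compared with the maxima of two sequences that approximate the mean
differences at distance `t` from the two ends of the sample. -/
lemma abs_mul_renyiStatistic_sub_max_le {y m₁ m₂ : ℕ → ℝ} {T : ℕ} {τ c R : ℝ} (hτ : 0 ≤ τ)
    (hc : 0 < c) (hR : 0 ≤ R)
    (h₁ : ∀ t ∈ trimmedHalf T τ, |c * meanDifference y T t - m₁ t| ≤ R)
    (h₂ : ∀ t ∈ trimmedHalf T τ, |c * meanDifference y T (T - t) + m₂ t| ≤ R) :
    |c * renyiStatistic y T τ - max (halfMax m₁ T τ) (halfMax m₂ T τ)| ≤ R := by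
  have hT : ∀ t ∈ trimmedHalf T τ, t ≤ T := fun t ht => by
    have := (mem_trimmedHalf.1 ht).2
    have h : (t : ℝ) ≤ T := this.trans (half_le_self (Nat.cast_nonneg T))
    exact_mod_cast h
  have hstat := renyiStatistic_nonneg y T τ
  have tri₁ : ∀ t ∈ trimmedHalf T τ, abs (c * |meanDifference y T t| - |m₁ t|) ≤ R := fun t ht => by
    have := (abs_abs_sub_abs_le_abs_sub (c * meanDifference y T t) (m₁ t)).trans (h₁ t ht)
    rwa [abs_mul, abs_of_pos hc] at this
  have tri₂ : ∀ t ∈ trimmedHalf T τ, abs (c * |meanDifference y T (T - t)| - |m₂ t|) ≤ R := by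
    intro t ht
    have h := h₂ t ht
    rw [← sub_neg_eq_add] at h
    have := (abs_abs_sub_abs_le_abs_sub (c * meanDifference y T (T - t)) (-m₂ t)).trans h
    rwa [abs_mul, abs_of_pos hc, abs_neg] at this
  rw [abs_le]
  constructor
  · have e₁ : halfMax m₁ T τ ≤ c * renyiStatistic y T τ + R := by
      refine halfMax_le (by positivity) fun t ht => ?_
      have h3 := mem_trimmedHalf.1 ht
      have h4 := mul_le_mul_of_nonneg_left
        (abs_meanDifference_le_renyiStatistic y (T := T) h3.1 (by linarith)) hc.le
      linarith [(abs_le.1 (tri₁ t ht)).1]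
    have e₂ : halfMax m₂ T τ ≤ c * renyiStatistic y T τ + R := by
      refine halfMax_le (by positivity) fun t ht => ?_
      have h3 := mem_trimmedHalf.1 ht
      have hcast : ((T - t : ℕ) : ℝ) = T - t := Nat.cast_sub (hT t ht)
      have h4 := mul_le_mul_of_nonneg_left
        (abs_meanDifference_le_renyiStatistic y (T := T) (t := T - t) (τ := τ) (by rw [hcast]; linarith)
          (by rw [hcast]; linarith)) hc.le
      linarith [(abs_le.1 (tri₂ t ht)).1]
    linarith [max_le e₁ e₂]
  · have hmax : 0 ≤ max (halfMax m₁ T τ) (halfMax m₂ T τ) :=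
      (halfMax_nonneg m₁ T τ).trans (le_max_left _ _)
    have : renyiStatistic y T τ ≤ (max (halfMax m₁ T τ) (halfMax m₂ T τ) + R) / c := by
      refine renyiStatistic_le (by positivity) fun t ht1 ht2 => ?_
      rw [le_div_iff₀' hc]
      -- Every admissible `t` is at distance at most `T / 2` from one end; in the second case that
      -- distance is `T - t`.
      rcases le_or_gt (t : ℝ) (T / 2) with h | h
      · have hmem : t ∈ trimmedHalf T τ := mem_trimmedHalf.2 ⟨ht1, h⟩
        linarith [(abs_le.1 (tri₁ t hmem)).2, abs_le_halfMax m₁ hmem,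
          le_max_left (halfMax m₁ T τ) (halfMax m₂ T τ)]
      · have htT : t ≤ T := by
          have : (t : ℝ) ≤ T := by linarith
          exact_mod_cast this
        have hcast : ((T - t : ℕ) : ℝ) = T - t := Nat.cast_sub htT
        have hmem : T - t ∈ trimmedHalf T τ :=
          mem_trimmedHalf.2 (by rw [hcast]; constructor <;> linarith)
        have h5 := (abs_le.1 (tri₂ _ hmem)).2
        rw [Nat.sub_sub_self htT] at h5
        linarith [abs_le_halfMax m₂ hmem, le_max_right (halfMax m₁ T τ) (halfMax m₂ T τ)]
    rw [le_div_iff₀' hc] at this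
    linarith

lemma sum_Icc_add_sum_Icc (y : ℕ → ℝ) {T t : ℕ} (ht : t ≤ T) :
    ∑ s ∈ Finset.Icc 1 t, y s + ∑ s ∈ Finset.Icc (t + 1) T, y s = ∑ s ∈ Finset.Icc 1 T, y s := by
  have h : ∀ a b : ℕ, Finset.Icc (a + 1) b = Finset.Ioc a b := fun a b => by
    ext s
    simp only [Finset.mem_Icc, Finset.mem_Ioc]
    omega
  rw [← zero_add 1, h, h, h]
  exact Finset.sum_Ioc_consecutive y (Nat.zero_le t) ht

/-- If a partial sum `U` of `r` terms, out of `T` terms with sum `S`, is close to `σ w`, then the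
normalized difference of means is close to `√τ / r * w`. -/
lemma abs_meanDifference_sub_wiener_le {T r : ℕ} {τ σ κ U S w y v : ℝ} (hτ : 1 ≤ τ) (hσ : 0 < σ)
    (hκ : 0 < κ) (hκ' : κ < 1 / 2) (hr : r ∈ trimmedHalf T τ) (hy : 0 ≤ y)
    (hU : |U - σ * w| ≤ y * (r : ℝ) ^ κ) (hw : |w| ≤ √T * v) :
    |√τ / σ * (1 / (r : ℝ) * U - 1 / ((T : ℝ) - r) * (S - U)) - √τ / r * w|
      ≤ τ ^ (κ - 1 / 2) * (y / σ) + √(τ / T) * (2 / σ * (|S / √T| + σ * v + y)) := by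
  obtain ⟨h1, h2⟩ := mem_trimmedHalf.1 hr
  have hτ0 : 0 < τ := by linarith
  have hr1 : 1 ≤ (r : ℝ) := hτ.trans h1
  have hr0 : 0 < (r : ℝ) := by linarith
  have hT0 : 0 < (T : ℝ) := by linarith
  have hTr : 0 < (T : ℝ) - r := by linarith
  have hsT : 0 < √(T : ℝ) := Real.sqrt_pos.2 hT0
  have hsτ : 0 < √τ := Real.sqrt_pos.2 hτ0
  have e : √τ / σ * (1 / (r : ℝ) * U - 1 / ((T : ℝ) - r) * (S - U)) - √τ / r * w
      = √τ / σ * (1 / r * (U - σ * w)) - √τ / σ * (1 / ((T : ℝ) - r) * (S - U)) := by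
    field_simp
    ring
  -- The approximation error of the short mean is of order `√τ * r ^ (κ - 1)`, largest at `r = τ`
  -- because `κ < 1`.
  have b1 : |√τ / σ * (1 / r * (U - σ * w))| ≤ τ ^ (κ - 1 / 2) * (y / σ) := by
    rw [abs_mul, abs_mul, abs_of_pos (div_pos hsτ hσ), abs_of_pos (one_div_pos.2 hr0)]
    have h3 : 1 / (r : ℝ) * |U - σ * w| ≤ y * τ ^ (κ - 1) := by
      calc 1 / (r : ℝ) * |U - σ * w| ≤ 1 / (r : ℝ) * (y * (r : ℝ) ^ κ) := by gcongr
        _ = y * (r : ℝ) ^ (κ - 1) := by rw [Real.rpow_sub_one hr0.ne']; ring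
        _ ≤ y * τ ^ (κ - 1) := by
          refine mul_le_mul_of_nonneg_left ?_ hy
          exact Real.rpow_le_rpow_of_nonpos hτ0 h1 (by linarith)
    calc √τ / σ * (1 / (r : ℝ) * |U - σ * w|) ≤ √τ / σ * (y * τ ^ (κ - 1)) := by gcongr
      _ = τ ^ (1 / 2 : ℝ) * τ ^ (κ - 1) * (y / σ) := by rw [Real.sqrt_eq_rpow]; ring
      _ = τ ^ (κ - 1 / 2) * (y / σ) := by
        rw [← Real.rpow_add hτ0]
        congr 2
        ring
  have hrT : (r : ℝ) ^ κ ≤ √T := by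
    rw [Real.sqrt_eq_rpow]
    calc (r : ℝ) ^ κ ≤ (r : ℝ) ^ (1 / 2 : ℝ) := Real.rpow_le_rpow_of_exponent_le hr1 hκ'.le
      _ ≤ (T : ℝ) ^ (1 / 2 : ℝ) := Real.rpow_le_rpow hr0.le (by linarith) (by norm_num)
  have hSU : |S - U| ≤ √T * (|S / √T| + σ * v + y) := by
    have h4 : |S| = √T * |S / √T| := by
      rw [abs_div, abs_of_pos hsT]
      field_simp
    have h5 : |U| ≤ √T * (σ * v + y) := by
      calc |U| = |(U - σ * w) + σ * w| := by ring_nf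
        _ ≤ |U - σ * w| + |σ * w| := abs_add_le _ _
        _ ≤ y * √T + σ * (√T * v) := by
          rw [abs_mul, abs_of_pos hσ]
          gcongr
          exact hU.trans (by gcongr)
        _ = √T * (σ * v + y) := by ring
    have := abs_sub S U
    linarith
  -- The long mean has at least `T / 2` terms, whence the factor `2 / T`; its sum is of order `√T`.
  have b2 : |√τ / σ * (1 / ((T : ℝ) - r) * (S - U))|
      ≤ √(τ / T) * (2 / σ * (|S / √T| + σ * v + y)) := by
    rw [abs_mul, abs_mul, abs_of_pos (div_pos hsτ hσ), abs_of_pos (one_div_pos.2 hTr)]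
    have h6 : 1 / ((T : ℝ) - r) ≤ 2 / T := by
      rw [div_le_div_iff₀ hTr hT0]
      linarith
    calc √τ / σ * (1 / ((T : ℝ) - r) * |S - U|)
        ≤ √τ / σ * (2 / T * (√T * (|S / √T| + σ * v + y))) := by gcongr
      _ = √(τ / T) * (2 / σ * (|S / √T| + σ * v + y)) := by
        rw [Real.sqrt_div hτ0.le]
        have : (T : ℝ) = √T * √T := (Real.mul_self_sqrt hT0.le).symm
        rw [show (2 : ℝ) / T = 2 / (√T * √T) by rw [← this]]
        field_simp
  rw [e]
  exact (abs_sub _ _).trans (add_le_add b1 b2)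

end

/-! ### Pathwise convergence of the maxima to the supremum. -/

section Limit

lemma bddAbove_range_abs_of_continuousOn {f : ℝ → ℝ} (hf : ContinuousOn f (Set.Icc 0 1)) :
    BddAbove (Set.range fun u : Set.Icc (0 : ℝ) 1 => |f u|) := by
  have h := (isCompact_Icc (a := (0 : ℝ)) (b := 1)).bddAbove_image hf.abs
  rw [Set.image_eq_range] at h
  exact h

/-- The points `τ / t`, `τ ≤ t ≤ T / 2`, become dense in `[0, 1]`. -/
lemma tendsto_halfMax_of_continuousOn {f : ℝ → ℝ} (hf : ContinuousOn f (Set.Icc 0 1)) {τ : ℕ → ℝ}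
    (hτ_top : Tendsto τ atTop atTop) (hτ_zero : Tendsto (fun T : ℕ => τ T / T) atTop (𝓝 0)) :
    Tendsto (fun T => halfMax (fun t => f (τ T / t)) T (τ T)) atTop
      (𝓝 (⨆ u : Set.Icc (0 : ℝ) 1, |f u|)) := by
  have hbdd := bddAbove_range_abs_of_continuousOn hf
  have hunit : ∀ {s : ℝ} {t : ℕ}, 0 < s → s ≤ t → s / t ∈ Set.Icc (0 : ℝ) 1 := by
    intro s t hs hst
    exact ⟨by positivity, div_le_one_of_le₀ hst (Nat.cast_nonneg t)⟩
  rw [tendsto_order]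
  constructor
  · intro a ha
    obtain ⟨⟨u₀, hu₀⟩, hau⟩ := exists_lt_of_lt_ciSup ha
    have hcont : ContinuousWithinAt (fun u => |f u|) (Set.Icc 0 1) u₀ := (hf u₀ hu₀).abs
    have hev := hcont.eventually_const_lt hau
    rw [Metric.nhdsWithin_basis_ball.eventually_iff] at hev
    obtain ⟨δ, hδ, hball⟩ := hev
    -- The near-maximizer `u₀` may be `0`, which is no `τ / t`; it is moved to a positive point
    -- within `δ / 2`.
    let u₁ := max u₀ (min (δ / 2) 1)
    have hu₁0 : 0 < u₁ := lt_max_of_lt_right (by positivity)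
    have hu₁1 : u₁ ≤ 1 := max_le hu₀.2 (min_le_right _ _)
    have hu₁δ : |u₁ - u₀| ≤ δ / 2 := by
      rw [abs_of_nonneg (sub_nonneg.2 (le_max_left _ _)), sub_le_iff_le_add]
      exact max_le (by linarith) ((min_le_left _ _).trans (by linarith [hu₀.1]))
    have hlim : Tendsto (fun T => u₁ / (1 + u₁ / τ T)) atTop (𝓝 u₁) := by
      have h1 : Tendsto (fun T => 1 + u₁ / τ T) atTop (𝓝 (1 + 0)) :=
        tendsto_const_nhds.add (hτ_top.const_div_atTop u₁)
      rw [add_zero] at h1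
      have h2 := (tendsto_const_nhds (x := u₁)).div h1 one_ne_zero
      rw [div_one] at h2
      exact h2
    have hsmall : ∀ᶠ T : ℕ in atTop, τ T / T < u₁ / 4 := (tendsto_order.1 hτ_zero).2 _ (by positivity)
    filter_upwards [hsmall, hτ_top.eventually_ge_atTop 1, eventually_ge_atTop 4,
      (tendsto_order.1 hlim).1 (u₁ - δ / 2) (by linarith)] with T h1 h2 h3 h4
    have hT : (4 : ℝ) ≤ T := by exact_mod_cast h3
    have hT0 : (0 : ℝ) < T := by linarith
    have hτ0 : 0 < τ T := by linarith
    -- With this choice `τ / t` lies just below `u₁`, and the rounding error vanishes as `τ → ∞`.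
    -- The condition `t ≤ T / 2` holds because `τ / T` is small.
    let t := ⌈τ T / u₁⌉₊
    have ht1 : τ T / u₁ ≤ t := Nat.le_ceil _
    have ht2 : (t : ℝ) < τ T / u₁ + 1 := Nat.ceil_lt_add_one (by positivity)
    have htτ : τ T ≤ t := le_trans (by rw [le_div_iff₀ hu₁0]; nlinarith) ht1
    have ht0 : (0 : ℝ) < t := hτ0.trans_le htτ
    have hmem : t ∈ trimmedHalf T (τ T) := by
      refine mem_trimmedHalf.2 ⟨htτ, ?_⟩
      have : τ T / u₁ < T / 4 := by
        rw [div_lt_iff₀ hT0] at h1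
        rw [div_lt_iff₀ hu₁0]
        linarith
      linarith
    have hle : τ T / t ≤ u₁ := by
      rw [div_le_iff₀ hu₁0] at ht1
      rw [div_le_iff₀ ht0]
      linarith
    have hge : u₁ / (1 + u₁ / τ T) ≤ τ T / t := by
      rw [div_le_div_iff₀ (by positivity) ht0]
      have : τ T * (1 + u₁ / τ T) = u₁ * (τ T / u₁ + 1) := by
        field_simp
      rw [this]
      exact mul_le_mul_of_nonneg_left ht2.le hu₁0.le
    have hdist : τ T / t ∈ Metric.ball u₀ δ ∩ Set.Icc 0 1 := by
      refine ⟨?_, hunit hτ0 htτ⟩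
      rw [Metric.mem_ball, Real.dist_eq, abs_lt]
      rw [abs_le] at hu₁δ
      constructor <;> linarith [le_max_left u₀ (min (δ / 2) 1)]
    exact (hball hdist).trans_le (abs_le_halfMax (fun t => f (τ T / t)) hmem)
  · intro a ha
    filter_upwards [hτ_top.eventually_gt_atTop 0] with T hT
    refine lt_of_le_of_lt (halfMax_le (Real.iSup_nonneg fun _ => abs_nonneg _) fun t ht => ?_) ha
    exact le_ciSup hbdd ⟨τ T / t, hunit hT (mem_trimmedHalf.1 ht).1⟩

end Limit

/-! ### Scaling, time inversion and the limit law of the weighted maxima. -/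

section Wiener

variable {Ω Ω' Ω'' : Type*} [MeasurableSpace Ω] [MeasurableSpace Ω'] [MeasurableSpace Ω'']
  {P : Measure Ω} {P' : Measure Ω'} {P'' : Measure Ω''} {W : ℝ → Ω' → ℝ}

lemma IsWienerOn.identDistrib_halfMax {V : ℝ → Ω → ℝ} {T : ℕ} {τ : ℝ}
    (hV : IsWienerOn P ((T : ℝ) / 2) V) (hW : IsWienerOn P' 1 W) (c u : ℕ → ℝ)
    (hu : ∀ t ∈ trimmedHalf T τ, u t ∈ Set.Icc (0 : ℝ) 1)
    (h : ∀ s ∈ trimmedHalf T τ, ∀ t ∈ trimmedHalf T τ,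
      c s * c t * min (s : ℝ) t = min (u s) (u t)) :
    IdentDistrib (fun ω => halfMax (fun t => c t * V t ω) T τ)
      (fun ω => halfMax (fun t => W (u t) ω) T τ) P P' := by
  have := hV.identDistrib_mul hW (by positivity) zero_le_one
    (fun t : trimmedHalf T τ => c t) (fun t => ((t : ℕ) : ℝ)) (fun t => u t)
    (fun t => ⟨Nat.cast_nonneg _, (mem_trimmedHalf.1 t.2).2⟩) (fun t => hu t t.2)
    (fun s t => h s s.2 t t.2)
  exact this.comp measurable_norm

/-- The covariance identity behind time inversion: `√τ / t * V t` has the covariances of `W (τ /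
t)`. -/
lemma mul_min_div_eq {a s t : ℝ} (hs : 0 < s) (ht : 0 < t) (ha : 0 ≤ a) :
    a / (s * t) * min s t = min (a / s) (a / t) := by
  rcases le_total s t with h | h
  · rw [min_eq_left h, min_eq_right (div_le_div_of_nonneg_left ha hs h)]
    field_simp
  · rw [min_eq_right h, min_eq_left (div_le_div_of_nonneg_left ha ht h)]
    field_simp

/-- Time inversion and scaling for the finite-dimensional laws of a Wiener process. -/
lemma IsWienerOn.identDistrib_halfMax_inversion {V : ℝ → Ω → ℝ} {T : ℕ} {τ : ℝ} (hτ : 0 < τ)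
    (hV : IsWienerOn P ((T : ℝ) / 2) V) (hW : IsWienerOn P' 1 W) :
    IdentDistrib (fun ω => halfMax (fun t => √τ / t * V t ω) T τ)
      (fun ω => halfMax (fun t => W (τ / t) ω) T τ) P P' := by
  have hpos : ∀ t ∈ trimmedHalf T τ, (0 : ℝ) < t := fun t ht => hτ.trans_le (mem_trimmedHalf.1 ht).1
  refine hV.identDistrib_halfMax hW (fun t => √τ / t) (fun t => τ / t) (fun t ht => ?_)
    fun s hs t ht => ?_
  · exact ⟨by positivity, div_le_one_of_le₀ (mem_trimmedHalf.1 ht).1 (hpos t ht).le⟩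
  · rw [← mul_min_div_eq (hpos s hs) (hpos t ht) hτ.le, div_mul_div_comm, Real.mul_self_sqrt hτ.le]

/-- By Brownian scaling the maximum has the law of one over points `t / T` of `W`, hence tails
dominated by those of the supremum of `|W|`, whatever `T`. -/
lemma boundedInProb_halfMax_wiener [IsFiniteMeasure P'] {V : ℕ → ℝ → Ω → ℝ}
    (hV : ∀ T : ℕ, IsWienerOn P ((T : ℝ) / 2) (V T)) (hW : IsWienerOn P' 1 W)
    (hsup : AEMeasurable (fun ω => ⨆ u : Set.Icc (0 : ℝ) 1, |W u ω|) P') :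
    BoundedInProb P fun T ω => halfMax (fun t => (√T)⁻¹ * V T t ω) T 1 := by
  refine BoundedInProb.of_measure_le hsup ?_
  filter_upwards [eventually_gt_atTop 0] with T hT M
  have hT0 : (0 : ℝ) < T := by exact_mod_cast hT
  have hle : ∀ t ∈ trimmedHalf T 1, ((t : ℝ) / T) ∈ Set.Icc (0 : ℝ) 1 := fun t ht =>
    ⟨by positivity, div_le_one_of_le₀
      ((mem_trimmedHalf.1 ht).2.trans (half_le_self hT0.le)) hT0.le⟩
  have hid : IdentDistrib (fun ω => halfMax (fun t => (√T)⁻¹ * V T t ω) T 1)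
      (fun ω => halfMax (fun t => W ((t : ℝ) / T) ω) T 1) P P' := by
    refine (hV T).identDistrib_halfMax hW (fun _ => (√T)⁻¹) (fun t => (t : ℝ) / T) hle
      fun s _ t _ => ?_
    rw [← mul_inv, Real.mul_self_sqrt hT0.le, min_div_div_right hT0.le]
    ring
  have h1 := hid.measure_mem_eq (s := Set.Ioi M) measurableSet_Ioi
  simp only [abs_of_nonneg (halfMax_nonneg _ _ _)]
  refine (le_of_eq h1).trans (measure_mono_ae ?_)
  filter_upwards [hW.continuous_paths] with ω hω h2
  have h3 : M < halfMax (fun t => W ((t : ℝ) / T) ω) T 1 := h2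
  refine h3.trans_le (halfMax_le (Real.iSup_nonneg fun _ => abs_nonneg _) fun t ht => ?_)
  exact le_ciSup (bddAbove_range_abs_of_continuousOn hω) ⟨(t : ℝ) / T, hle t ht⟩

/-- Convergence in distribution sees only laws, so it may be proved on another space where it holds
almost surely. -/
lemma MeasureTheory.TendstoInDistribution.of_identDistrib [IsProbabilityMeasure P]
    {Ω₁ : Type*} [MeasurableSpace Ω₁] {Q : Measure Ω₁} [IsProbabilityMeasure Q]
    [IsProbabilityMeasure P''] {X : ℕ → Ω → ℝ} {Y : ℕ → Ω₁ → ℝ} {Z : Ω₁ → ℝ} {Z' : Ω'' → ℝ}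
    (h : TendstoInDistribution Y atTop Z (fun _ => Q) Q)
    (hXY : ∀ n, IdentDistrib (X n) (Y n) P Q) (hZ : IdentDistrib Z' Z P'' Q) :
    TendstoInDistribution X atTop Z' (fun _ => P) P'' := by
  refine ⟨fun n => (hXY n).aemeasurable_fst, hZ.aemeasurable_fst, ?_⟩
  have hlim : (⟨P''.map Z', Measure.isProbabilityMeasure_map hZ.aemeasurable_fst⟩ :
      ProbabilityMeasure ℝ)
      = ⟨Q.map Z, Measure.isProbabilityMeasure_map hZ.aemeasurable_snd⟩ := Subtype.ext hZ.map_eq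
  rw [hlim]
  exact h.tendsto.congr fun n => Subtype.ext (hXY n).map_eq.symm

/-- The limit law of the maximum of two independent maxima of weighted Wiener processes. -/
lemma tendstoInDistribution_max_halfMax [IsProbabilityMeasure P] [IsProbabilityMeasure P']
    [IsProbabilityMeasure P''] {V₁ V₂ : ℕ → ℝ → Ω → ℝ}
    (hV₁ : ∀ T : ℕ, IsWienerOn P ((T : ℝ) / 2) (V₁ T))
    (hV₂ : ∀ T : ℕ, IsWienerOn P ((T : ℝ) / 2) (V₂ T))
    (hind : ∀ T : ℕ, IndepFun (fun ω (u : Set.Icc (0 : ℝ) ((T : ℝ) / 2)) => V₁ T u ω)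
      (fun ω (u : Set.Icc (0 : ℝ) ((T : ℝ) / 2)) => V₂ T u ω) P)
    (hW : IsWienerOn P' 1 W) {ξ₁ ξ₂ : Ω'' → ℝ} (hξ : IndepFun ξ₁ ξ₂ P'')
    (hξ₁ : IdentDistrib ξ₁ (fun ω => ⨆ u : Set.Icc (0 : ℝ) 1, |W u ω|) P'' P')
    (hξ₂ : IdentDistrib ξ₂ (fun ω => ⨆ u : Set.Icc (0 : ℝ) 1, |W u ω|) P'' P')
    {τ : ℕ → ℝ} (hτ_pos : ∀ T, 0 < τ T) (hτ_top : Tendsto τ atTop atTop)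
    (hτ_zero : Tendsto (fun T : ℕ => τ T / T) atTop (𝓝 0)) :
    TendstoInDistribution
      (fun T ω => max (halfMax (fun t => √(τ T) / t * V₁ T t ω) T (τ T))
        (halfMax (fun t => √(τ T) / t * V₂ T t ω) T (τ T)))
      atTop (fun ω => max (ξ₁ ω) (ξ₂ ω)) (fun _ => P) P'' := by
  let G : ℕ → Ω' → ℝ := fun T ω => halfMax (fun t => W (τ T / t) ω) T (τ T)
  let S : Ω' → ℝ := fun ω => ⨆ u : Set.Icc (0 : ℝ) 1, |W u ω|
  have hS : AEMeasurable S P' := hξ₁.aemeasurable_snd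
  have hid₁ : ∀ T, IdentDistrib _ (G T) P P' := fun T =>
    (hV₁ T).identDistrib_halfMax_inversion (hτ_pos T) hW
  have hid₂ : ∀ T, IdentDistrib _ (G T) P P' := fun T =>
    (hV₂ T).identDistrib_halfMax_inversion (hτ_pos T) hW
  have hG : ∀ T, AEMeasurable (G T) P' := fun T => (hid₁ T).aemeasurable_snd
  have hfst : ∀ {F : Ω' → ℝ}, AEMeasurable F P' →
      IdentDistrib F (fun p : Ω' × Ω' => F p.1) P' (P'.prod P') := fun {F} hF =>
    ⟨hF, hF.comp_fst, by
      change _ = Measure.map (F ∘ Prod.fst) _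
      rw [← AEMeasurable.map_map_of_aemeasurable (g := F) (f := Prod.fst)
        (by rwa [measurePreserving_fst.map_eq]) measurable_fst.aemeasurable,
        measurePreserving_fst.map_eq]⟩
  have hsnd : ∀ {F : Ω' → ℝ}, AEMeasurable F P' →
      IdentDistrib F (fun p : Ω' × Ω' => F p.2) P' (P'.prod P') := fun {F} hF =>
    ⟨hF, hF.comp_snd, by
      change _ = Measure.map (F ∘ Prod.snd) _
      rw [← AEMeasurable.map_map_of_aemeasurable (g := F) (f := Prod.snd)
        (by rwa [measurePreserving_snd.map_eq]) measurable_snd.aemeasurable,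
        measurePreserving_snd.map_eq]⟩
  -- Two independent copies of one `W` on the product space replace the `T`-dependent processes;
  -- there the convergence is pathwise.
  have hconv : TendstoInDistribution (fun T (p : Ω' × Ω') => max (G T p.1) (G T p.2)) atTop
      (fun p => max (S p.1) (S p.2)) (fun _ => P'.prod P') (P'.prod P') := by
    have hpath : ∀ᵐ ω ∂P', Tendsto (fun T => G T ω) atTop (𝓝 (S ω)) := by
      filter_upwards [hW.continuous_paths] with ω hω
      exact tendsto_halfMax_of_continuousOn hω hτ_top hτ_zero
    refine tendstoInDistribution_of_ae_tendsto (fun T => (hG T).comp_fst.max (hG T).comp_snd)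
      (hS.comp_fst.max hS.comp_snd) ?_
    filter_upwards [measurePreserving_fst.quasiMeasurePreserving.ae hpath,
      measurePreserving_snd.quasiMeasurePreserving.ae hpath] with p h1 h2
    exact h1.max h2
  refine hconv.of_identDistrib (fun T => ?_) ?_
  -- Each maximum is a measurable function of finitely many path coordinates, so independence of the
  -- processes passes to the maxima.
  · have hmeas : Measurable fun p : Set.Icc (0 : ℝ) ((T : ℝ) / 2) → ℝ =>
        ‖fun t : trimmedHalf T (τ T) => √(τ T) / ((t : ℕ) : ℝ) *
          p ⟨((t : ℕ) : ℝ), Nat.cast_nonneg _, (mem_trimmedHalf.1 t.2).2⟩‖ := by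
      refine measurable_norm.comp (measurable_pi_lambda _ fun t => ?_)
      fun_prop
    have hind' := (hind T).comp hmeas hmeas
    exact (IdentDistrib.prodMk ((hid₁ T).trans (hfst (hG T))) ((hid₂ T).trans (hsnd (hG T)))
      hind' (indepFun_prod₀ (hG T) (hG T))).comp (measurable_fst.max measurable_snd)
  · exact (IdentDistrib.prodMk (hξ₁.trans (hfst hS)) (hξ₂.trans (hsnd hS)) hξ
      (indepFun_prod₀ hS hS)).comp (measurable_fst.max measurable_snd)

end Wiener

/-! ### Errors: from partial sums to weighted Wiener processes. -/

section Approximation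

variable {Ω Ω' : Type*} [MeasurableSpace Ω] [MeasurableSpace Ω'] {P : Measure Ω} {P' : Measure Ω'}
  {e : ℕ → Ω → ℝ} {σ : ℝ}

/-- Restricts the suprema over real `x` to integers, where floors are exact, and measures the
right-hand approximation by the distance `t` from the end. -/
lemma WienerApproximation.exists_bounds (h : WienerApproximation P e σ) :
    ∃ (κ : ℝ) (W₁ W₂ : ℕ → ℝ → Ω → ℝ) (y₁ y₂ : ℕ → Ω → ℝ), 0 < κ ∧ κ < 1 / 2 ∧
      (∀ T : ℕ, IsWienerOn P ((T : ℝ) / 2) (W₁ T)) ∧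
      (∀ T : ℕ, IsWienerOn P ((T : ℝ) / 2) (W₂ T)) ∧
      (∀ T : ℕ, IndepFun (fun ω (u : Set.Icc (0 : ℝ) ((T : ℝ) / 2)) => W₁ T u ω)
        (fun ω (u : Set.Icc (0 : ℝ) ((T : ℝ) / 2)) => W₂ T u ω) P) ∧
      BoundedInProb P y₁ ∧ BoundedInProb P y₂ ∧ (∀ T ω, 0 ≤ y₁ T ω) ∧ (∀ T ω, 0 ≤ y₂ T ω) ∧
      ∀ T ω, ∀ t ∈ trimmedHalf T 1,
        |∑ s ∈ Finset.Icc 1 t, e s ω - σ * W₁ T t ω| ≤ y₁ T ω * (t : ℝ) ^ κ ∧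
        |∑ s ∈ Finset.Icc (T - t + 1) T, e s ω - σ * W₂ T t ω| ≤ y₂ T ω * (t : ℝ) ^ κ := by
  obtain ⟨κ, W₁, W₂, hκ, hκ', hW, h₁, h₂⟩ := h
  let m₁ : ℕ → Ω → ℕ → ℝ := fun T ω t =>
    (t : ℝ) ^ (-κ) * |∑ s ∈ Finset.Icc 1 t, e s ω - σ * W₁ T t ω|
  let m₂ : ℕ → Ω → ℕ → ℝ := fun T ω t =>
    (t : ℝ) ^ (-κ) * |∑ s ∈ Finset.Icc (T - t + 1) T, e s ω - σ * W₂ T t ω|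
  have undo : ∀ {T t : ℕ} {z y : ℝ}, t ∈ trimmedHalf T 1 → abs ((t : ℝ) ^ (-κ) * |z|) ≤ y →
      |z| ≤ y * (t : ℝ) ^ κ := by
    intro T t z y ht hy
    have ht0 : (0 : ℝ) < t := zero_lt_one.trans_le (mem_trimmedHalf.1 ht).1
    have hpos : (0 : ℝ) < (t : ℝ) ^ κ := Real.rpow_pos_of_pos ht0 κ
    rw [abs_of_nonneg (by positivity), Real.rpow_neg ht0.le, inv_mul_le_iff₀ hpos] at hy
    linarith
  refine ⟨κ, W₁, W₂, fun T ω => halfMax (m₁ T ω) T 1, fun T ω => halfMax (m₂ T ω) T 1, hκ, hκ',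
    fun T => (hW T).1, fun T => (hW T).2.1, fun T => (hW T).2.2, ?_, ?_,
    fun T ω => halfMax_nonneg _ _ _, fun T ω => halfMax_nonneg _ _ _, fun T ω t ht => ⟨?_, ?_⟩⟩
  · refine h₁.boundedInProb fun T ω => ?_
    rw [abs_of_nonneg (halfMax_nonneg _ _ _)]
    refine ofReal_halfMax_le fun t ht => ?_
    refine le_trans (le_of_eq ?_) (le_iSup₂ (f := fun x (_ : x ∈ Set.Icc (1 : ℝ) ((T : ℝ) / 2)) =>
      ENNReal.ofReal (x ^ (-κ) * |∑ s ∈ Finset.Icc 1 ⌊x⌋₊, e s ω - σ * W₁ T x ω|))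
      (t : ℝ) (mem_trimmedHalf.1 ht))
    simp only [m₁, Nat.floor_natCast]
    rw [abs_of_nonneg (by positivity)]
  · refine h₂.boundedInProb fun T ω => ?_
    rw [abs_of_nonneg (halfMax_nonneg _ _ _)]
    refine ofReal_halfMax_le fun t ht => ?_
    obtain ⟨ht1, ht2⟩ := mem_trimmedHalf.1 ht
    have htT : t ≤ T := by
      have : (t : ℝ) ≤ T := by linarith
      exact_mod_cast this
    refine le_trans (le_of_eq ?_) (le_iSup₂
      (f := fun x (_ : x ∈ Set.Icc ((T : ℝ) / 2) ((T : ℝ) - 1)) =>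
      ENNReal.ofReal (((T : ℝ) - x) ^ (-κ) *
        |∑ s ∈ Finset.Icc (⌊x⌋₊ + 1) T, e s ω - σ * W₂ T ((T : ℝ) - x) ω|))
      (((T - t : ℕ) : ℝ)) (by rw [Nat.cast_sub htT]; constructor <;> linarith))
    simp only [m₂, Nat.floor_natCast]
    rw [Nat.cast_sub htT, sub_sub_cancel, abs_of_nonneg (by positivity)]
  · exact undo ht (abs_le_halfMax (m₁ T ω) ht)
  · exact undo ht (abs_le_halfMax (m₂ T ω) ht)

lemma tendsto_sqrt_div_zero {τ : ℕ → ℝ} (hτ_zero : Tendsto (fun T : ℕ => τ T / T) atTop (𝓝 0)) :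
    Tendsto (fun T : ℕ => √(τ T / T)) atTop (𝓝 0) := by
  simpa using hτ_zero.sqrt

/-- The normalized mean differences of the errors are uniformly close to weighted Wiener
processes near both ends of the sample. -/
lemma exists_meanDifference_error_bound [IsProbabilityMeasure P] [IsFiniteMeasure P']
    {C : ℝ} (he : LinearSecondMoment P e C) (hσ : 0 < σ) {κ : ℝ} (hκ : 0 < κ) (hκ' : κ < 1 / 2)
    {W₁ W₂ : ℕ → ℝ → Ω → ℝ} {y₁ y₂ : ℕ → Ω → ℝ}
    (hW₁ : ∀ T : ℕ, IsWienerOn P ((T : ℝ) / 2) (W₁ T))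
    (hW₂ : ∀ T : ℕ, IsWienerOn P ((T : ℝ) / 2) (W₂ T))
    (hy₁ : BoundedInProb P y₁) (hy₂ : BoundedInProb P y₂)
    (hy₁0 : ∀ T ω, 0 ≤ y₁ T ω) (hy₂0 : ∀ T ω, 0 ≤ y₂ T ω)
    (hy : ∀ T ω, ∀ t ∈ trimmedHalf T 1,
        |∑ s ∈ Finset.Icc 1 t, e s ω - σ * W₁ T t ω| ≤ y₁ T ω * (t : ℝ) ^ κ ∧
        |∑ s ∈ Finset.Icc (T - t + 1) T, e s ω - σ * W₂ T t ω| ≤ y₂ T ω * (t : ℝ) ^ κ)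
    {W : ℝ → Ω' → ℝ} (hW : IsWienerOn P' 1 W)
    (hsup : AEMeasurable (fun ω => ⨆ u : Set.Icc (0 : ℝ) 1, |W u ω|) P')
    {τ : ℕ → ℝ} (hτ_one : ∀ T, 1 ≤ τ T) (hτ_top : Tendsto τ atTop atTop)
    (hτ_zero : Tendsto (fun T : ℕ => τ T / T) atTop (𝓝 0)) :
    ∃ R : ℕ → Ω → ℝ, TendstoInMeasure P R atTop (fun _ => 0) ∧ (∀ T ω, 0 ≤ R T ω) ∧
      ∀ T ω, ∀ t ∈ trimmedHalf T (τ T),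
        |√(τ T) / σ * meanDifference (fun s => e s ω) T t - √(τ T) / t * W₁ T t ω| ≤ R T ω ∧
        |√(τ T) / σ * meanDifference (fun s => e s ω) T (T - t) + √(τ T) / t * W₂ T t ω|
          ≤ R T ω := by
  let v₁ : ℕ → Ω → ℝ := fun T ω => halfMax (fun t => (√T)⁻¹ * W₁ T t ω) T 1
  let v₂ : ℕ → Ω → ℝ := fun T ω => halfMax (fun t => (√T)⁻¹ * W₂ T t ω) T 1
  let y : ℕ → Ω → ℝ := fun T ω => y₁ T ω + y₂ T ω
  let v : ℕ → Ω → ℝ := fun T ω => v₁ T ω + v₂ T ω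
  let S : ℕ → Ω → ℝ := fun T ω => ∑ s ∈ Finset.Icc 1 T, e s ω
  have hyb : BoundedInProb P y := hy₁.add hy₂
  have hvb : BoundedInProb P v :=
    (boundedInProb_halfMax_wiener hW₁ hW hsup).add (boundedInProb_halfMax_wiener hW₂ hW hsup)
  have hv₁0 : ∀ T ω, 0 ≤ v₁ T ω := fun T ω => halfMax_nonneg _ _ _
  have hv₂0 : ∀ T ω, 0 ≤ v₂ T ω := fun T ω => halfMax_nonneg _ _ _
  have hR₁ : TendstoInMeasure P (fun T ω => τ T ^ (κ - 1 / 2) * (y T ω / σ)) atTop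
      fun _ => 0 := by
    have h1 : BoundedInProb P fun T ω => y T ω / σ := by
      simpa only [div_eq_mul_inv] using hyb.mul (BoundedInProb.const σ⁻¹)
    refine h1.tendstoInMeasure_mul ?_
    have h2 := (tendsto_rpow_neg_atTop (y := 1 / 2 - κ) (by linarith)).comp hτ_top
    simpa [Function.comp_def] using h2
  have hR₂ : TendstoInMeasure P
      (fun T ω => √(τ T / T) * (2 / σ * (|S T ω / √T| + σ * v T ω + y T ω))) atTop fun _ => 0 :=
    ((BoundedInProb.const (2 / σ)).mul ((he.boundedInProb_sum_div_sqrt.abs.add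
      ((BoundedInProb.const σ).mul hvb)).add hyb)).tendstoInMeasure_mul
      (tendsto_sqrt_div_zero hτ_zero)
  have hw : ∀ {V : ℕ → ℝ → Ω → ℝ} {T t : ℕ} {ω : Ω}, t ∈ trimmedHalf T 1 →
      |V T t ω| ≤ √T * halfMax (fun t => (√T)⁻¹ * V T t ω) T 1 := by
    intro V T t ω ht
    have hT0 : (0 : ℝ) < T := by linarith [(mem_trimmedHalf.1 ht).1, (mem_trimmedHalf.1 ht).2]
    have h1 := abs_le_halfMax (fun t => (√T)⁻¹ * V T t ω) ht
    have hs : 0 < √(T : ℝ) := Real.sqrt_pos.2 hT0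
    rw [abs_mul, abs_of_pos (inv_pos.2 hs), inv_mul_le_iff₀ hs] at h1
    exact h1
  refine ⟨_, TendstoInMeasure.add_zero hR₁ hR₂, fun T ω => ?_, fun T ω t ht => ?_⟩
  · have := hτ_one T
    have := hy₁0 T ω
    have := hy₂0 T ω
    have := hv₁0 T ω
    have := hv₂0 T ω
    simp only [y, v]
    positivity
  · have ht1 := trimmedHalf_subset (hτ_one T) ht
    obtain ⟨hl, hr⟩ := hy T ω t ht1
    have htT : t ≤ T := by
      have : (t : ℝ) ≤ T := by
        linarith [(mem_trimmedHalf.1 ht1).1, (mem_trimmedHalf.1 ht1).2]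
      exact_mod_cast this
    have hpow : 0 ≤ (t : ℝ) ^ κ := by positivity
    have hsq : 0 ≤ √(T : ℝ) := Real.sqrt_nonneg _
    constructor
    · have h1 := abs_meanDifference_sub_wiener_le (S := S T ω) (y := y T ω) (v := v T ω)
        (hτ_one T) hσ hκ hκ' ht (add_nonneg (hy₁0 T ω) (hy₂0 T ω))
        (hl.trans (mul_le_mul_of_nonneg_right (by simp [y, hy₂0]) hpow))
        ((hw ht1).trans (mul_le_mul_of_nonneg_left (by simp [v, v₁, hv₂0]) hsq))
      have h2 : S T ω - ∑ s ∈ Finset.Icc 1 t, e s ω = ∑ s ∈ Finset.Icc (t + 1) T, e s ω := by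
        simp only [S]
        rw [← sum_Icc_add_sum_Icc (fun s => e s ω) htT]
        ring
      rw [h2] at h1
      exact h1
    · have h1 := abs_meanDifference_sub_wiener_le (S := S T ω) (y := y T ω) (v := v T ω)
        (hτ_one T) hσ hκ hκ' ht (add_nonneg (hy₁0 T ω) (hy₂0 T ω))
        (hr.trans (mul_le_mul_of_nonneg_right (by simp [y, hy₁0]) hpow))
        ((hw ht1).trans (mul_le_mul_of_nonneg_left (by simp [v, v₂, hv₁0]) hsq))
      have h2 : S T ω - ∑ s ∈ Finset.Icc (T - t + 1) T, e s ω
          = ∑ s ∈ Finset.Icc 1 (T - t), e s ω := by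
        simp only [S]
        rw [← sum_Icc_add_sum_Icc (fun s => e s ω) (Nat.sub_le T t)]
        ring
      -- Here the short sum is the final one, which enters the mean difference with a minus sign;
      -- hence the plus sign in front of `W₂`.
      rw [h2, ← abs_neg] at h1
      refine le_trans (le_of_eq ?_) h1
      congr 1
      rw [meanDifference, Nat.cast_sub htT, sub_sub_cancel]
      ring

end Approximation

/-! ### From residuals to errors. -/

section Regression

variable {Ω : Type*} [MeasurableSpace Ω] {P : Measure Ω} {d : ℕ} {x : ℕ → Ω → Fin d → ℝ}
  {X e : ℕ → Ω → ℝ}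

/-- Centring by `m` leaves the mean difference unchanged, and each of the two centred means is at
most `Y`. -/
lemma abs_meanDifference_le_of_means {z : ℕ → ℝ} {m Y : ℝ} {T t : ℕ} (ht : 1 ≤ t) (htT : t < T)
    (h₁ : |∑ s ∈ Finset.Icc 1 t, (z s - m)| ≤ t * Y)
    (h₂ : |∑ s ∈ Finset.Icc (t + 1) T, (z s - m)| ≤ ((T : ℝ) - t) * Y) :
    |meanDifference z T t| ≤ 2 * Y := by
  have ht0 : (0 : ℝ) < t := by exact_mod_cast ht
  have hTt0 : (0 : ℝ) < (T : ℝ) - t := sub_pos.2 (by exact_mod_cast htT)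
  have h := meanDifference_sub z (fun _ => m) T t
  rw [meanDifference_const m ht htT, sub_zero] at h
  rw [← h, meanDifference]
  refine (abs_sub _ _).trans ?_
  rw [abs_mul, abs_mul, abs_of_pos (one_div_pos.2 ht0), abs_of_pos (one_div_pos.2 hTt0)]
  have e₁ : 1 / (t : ℝ) * |∑ s ∈ Finset.Icc 1 t, (z s - m)| ≤ Y := by
    rw [one_div, inv_mul_le_iff₀ ht0]
    exact h₁
  have e₂ : 1 / ((T : ℝ) - t) * |∑ s ∈ Finset.Icc (t + 1) T, (z s - m)| ≤ Y := by
    rw [one_div, inv_mul_le_iff₀ hTt0]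
    exact h₂
  linarith

/-- Replacing the errors by the least squares residuals changes the normalized mean differences by
a quantity that tends to `0` in probability, outside of events of vanishing probability. -/
lemma exists_meanDifference_residual_bound [IsProbabilityMeasure P]
    (hx_meas : ∀ t, Measurable (x t)) {b : Fin d → ℝ}
    (hmodel : ∀ t, 1 ≤ t → ∀ ω, X t ω = x t ω ⬝ᵥ b + e t ω)
    {τ : ℕ → ℝ} (hτ_one : ∀ T, 1 ≤ τ T)
    (hτ_zero : Tendsto (fun T : ℕ => τ T / T) atTop (𝓝 0)) {σ : ℝ} (hσ : 0 < σ)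
    (hindep : IndepFun (fun ω (t : ℕ) => x t ω) (fun ω (t : ℕ) => e t ω) P)
    (hx_erg : IsStationaryErgodic P x) (hx_sq : ∀ t i, MemLp (fun ω => x t ω i) 2 P)
    {c ζ : ℝ} (hc : 0 < c) (hζ : 2 < ζ) (hx_cov : ∀ (i : Fin d) (t : ℕ),
      |covariance (fun ω => x 0 ω i) (fun ω => x t ω i) P| ≤ c * ((t : ℝ) + 1) ^ (-ζ))
    (he_sq : ∀ t, MemLp (e t) 2 P)
    {c' ζ' : ℝ} (hc' : 0 < c') (hζ' : 2 < ζ') (he_cov : ∀ t s : ℕ,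
      |∫ ω, e t ω * e s ω ∂P| ≤ c' * (|(t : ℝ) - (s : ℝ)| + 1) ^ (-ζ'))
    (hC : IsUnit (secondMomentMatrix P x).det) :
    ∃ (R : ℕ → Ω → ℝ) (B : ℕ → Set Ω), TendstoInMeasure P R atTop (fun _ => 0) ∧
      (∀ T ω, 0 ≤ R T ω) ∧ Tendsto (fun T => P (B T)) atTop (𝓝 0) ∧
      ∀ᶠ T : ℕ in atTop, ∀ ω, ω ∉ B T → ∀ t : ℕ, τ T ≤ t → (t : ℝ) ≤ T - τ T →
        |√(τ T) / σ * meanDifference (olsResidual (fun t => x t ω) (fun t => X t ω) T) T t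
          - √(τ T) / σ * meanDifference (fun s => e s ω) T t| ≤ R T ω := by
  choose Cx hCx using fun i => hx_erg.exists_linearSecondMoment_centered hx_meas hx_sq hc.le
    (by linarith) i (hx_cov i)
  choose Y hYb hY0 hY using fun i => (hCx i).exists_boundedInProb_means
  have hV : ∀ j : Fin d, ∃ C, LinearSecondMoment P (fun t ω => x t ω j * e t ω) C := fun j =>
    exists_linearSecondMoment_mul (hindep.comp (φ := fun f : ℕ → Fin d → ℝ => fun t => f t j)
      (ψ := fun g : ℕ → ℝ => g) (by fun_prop) measurable_id) (fun t => hx_sq t j) he_sq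
      (fun t s => hx_erg.abs_integral_mul_le hx_meas hx_sq j t s) hc'.le (by linarith) he_cov
  choose CV hCV using hV
  obtain ⟨η, K, hη, hK⟩ := (secondMomentMatrix P x).exists_inv_bound hC
  let G : ℕ → Ω → Matrix (Fin d) (Fin d) ℝ := fun T ω =>
    (designMatrix (fun t => x t ω) T)ᵀ * designMatrix (fun t => x t ω) T
  -- The exceptional event: some entry of the normalized Gram matrix is at least `η` from its limit.
  -- Off it, the matrix is invertible with inverse entries bounded by `K`.
  let B : ℕ → Set Ω := fun T => ⋃ i, ⋃ j,
    {ω | η ≤ ‖(T : ℝ)⁻¹ * G T ω i j - secondMomentMatrix P x i j‖}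
  let V : Fin d → ℕ → Ω → ℝ := fun j T ω => (∑ s ∈ Finset.Icc 1 T, x s ω j * e s ω) / √T
  let F : ℕ → Ω → ℝ := fun T ω => (1 / σ * (2 * |K|)) * ((∑ i, Y i T ω) * ∑ j, |V j T ω|)
  refine ⟨fun T ω => √(τ T / T) * F T ω, B, ?_, ?_, ?_, ?_⟩
  · refine BoundedInProb.tendstoInMeasure_mul ?_ (tendsto_sqrt_div_zero hτ_zero)
    exact (BoundedInProb.const _).mul ((BoundedInProb.sum _ fun i _ => hYb i).mul
      (BoundedInProb.sum _ fun j _ => (hCV j).boundedInProb_sum_div_sqrt.abs))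
  · intro T ω
    have h1 : 0 ≤ ∑ i, Y i T ω := Finset.sum_nonneg fun i _ => hY0 i T ω
    have h2 : 0 ≤ ∑ j, |V j T ω| := Finset.sum_nonneg fun j _ => abs_nonneg _
    positivity
  · have h1 : ∀ i j, Tendsto
        (fun T : ℕ => P {ω | η ≤ ‖(T : ℝ)⁻¹ * G T ω i j - secondMomentMatrix P x i j‖})
        atTop (𝓝 0) := fun i j =>
      tendstoInMeasure_iff_norm.1 (hx_erg.tendstoInMeasure_gram hx_meas hx_sq i j) η hη
    have h2 : Tendsto (fun T : ℕ => ∑ i, ∑ j,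
        P {ω | η ≤ ‖(T : ℝ)⁻¹ * G T ω i j - secondMomentMatrix P x i j‖}) atTop (𝓝 0) := by
      simpa using tendsto_finsetSum Finset.univ fun i _ =>
        tendsto_finsetSum Finset.univ fun j _ => h1 i j
    refine tendsto_of_tendsto_of_tendsto_of_le_of_le tendsto_const_nhds h2 (fun _ => zero_le)
      fun T => ?_
    refine (measure_iUnion_fintype_le _ _).trans (Finset.sum_le_sum fun i _ => ?_)
    exact measure_iUnion_fintype_le _ _
  · filter_upwards [eventually_gt_atTop 0] with T hT ω hω t ht1 ht2
    have hT0 : (0 : ℝ) < T := by exact_mod_cast hT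
    have hτ1 := hτ_one T
    have ht : 1 ≤ t := by
      have : (1 : ℝ) ≤ t := hτ1.trans ht1
      exact_mod_cast this
    have htT : t < T := by
      have : (t : ℝ) < T := by linarith
      exact_mod_cast this
    have hclose : ∀ i j, |((T : ℝ)⁻¹ • G T ω) i j - secondMomentMatrix P x i j| < η := by
      intro i j
      simp only [B, Set.mem_iUnion, not_exists] at hω
      exact not_le.1 (hω i j)
    obtain ⟨hdet, hinv⟩ := hK _ hclose
    have hdetG : IsUnit (G T ω).det := by
      rw [Matrix.det_smul] at hdet
      exact isUnit_of_mul_isUnit_right hdet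
    set δ := olsEstimator (fun t => x t ω) (fun t => e t ω) T with hδ
    have hest : olsEstimator (fun t => x t ω) (fun t => X t ω) T = b + δ :=
      olsEstimator_eq_add _ _ _ b (fun s hs => hmodel s (Finset.mem_Icc.1 hs).1 ω) hdetG
    have hres : ∀ s ∈ Finset.Icc 1 T, olsResidual (fun t => x t ω) (fun t => X t ω) T s
        = e s ω - ∑ i, x s ω i * δ i := by
      intro s hs
      rw [olsResidual, hest, hmodel s (Finset.mem_Icc.1 hs).1 ω, dotProduct_add]
      simp only [dotProduct]
      ring
    -- The estimation error is of order `T^(-1/2)`, since `V j T` is bounded in probability.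
    have hδle : ∀ i, |δ i| ≤ |K| * ((√T)⁻¹ * ∑ j, |V j T ω|) := by
      intro i
      refine (abs_olsEstimator_le _ _ hT.ne' (fun i j => (hinv i j).trans (le_abs_self K))
        hdetG i).trans (le_of_eq ?_)
      rw [Finset.mul_sum (a := (√T)⁻¹)]
      congr 1
      refine Finset.sum_congr rfl fun j _ => ?_
      have hsT : 0 < √(T : ℝ) := Real.sqrt_pos.2 hT0
      simp only [V]
      rw [abs_mul, abs_div, abs_of_pos hsT, abs_of_pos (inv_pos.2 hT0), div_eq_inv_mul,
        ← mul_assoc, ← mul_inv, Real.mul_self_sqrt hT0.le]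
    have hD : ∀ i, |meanDifference (fun s => x s ω i) T t| ≤ 2 * Y i T ω := by
      intro i
      refine abs_meanDifference_le_of_means (m := ∫ ω', x 0 ω' i ∂P) ht htT
        (hY i T ω t (Finset.mem_Icc.2 ⟨ht, htT.le⟩)).1 ?_
      have := (hY i T ω (T - t) (Finset.mem_Icc.2 ⟨by omega, Nat.sub_le _ _⟩)).2
      rwa [Nat.sub_sub_self htT.le, Nat.cast_sub htT.le] at this
    have hcτ : 0 ≤ √(τ T) / σ := by positivity
    rw [meanDifference_congr htT.le hres, meanDifference_sub, meanDifference_sum, mul_sub,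
      sub_sub_cancel_left, abs_neg, abs_mul, abs_of_nonneg hcτ]
    calc √(τ T) / σ * |∑ i, meanDifference (fun s => x s ω i) T t * δ i|
        ≤ √(τ T) / σ * ∑ i, 2 * Y i T ω * (|K| * ((√T)⁻¹ * ∑ j, |V j T ω|)) := by
          gcongr
          refine (Finset.abs_sum_le_sum_abs _ _).trans (Finset.sum_le_sum fun i _ => ?_)
          rw [abs_mul]
          exact mul_le_mul (hD i) (hδle i) (abs_nonneg _)
            (mul_nonneg zero_le_two (hY0 i T ω))
      _ = √(τ T / T) * F T ω := by
          rw [← Finset.sum_mul, ← Finset.mul_sum, Real.sqrt_div (by linarith)]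
          simp only [F]
          ring

end Regression

/-! ### Measurability of the statistic. -/

section Measurability

variable {Ω : Type*} [MeasurableSpace Ω] {d : ℕ} {x : ℕ → Ω → Fin d → ℝ} {X : ℕ → Ω → ℝ}

/-- Cramer's formula: the inverse is the adjugate times `det⁻¹`, with `0⁻¹ = 0` covering singular
matrices. -/
lemma measurable_matrix_inv_apply {A : Ω → Matrix (Fin d) (Fin d) ℝ}
    (hA : ∀ i j, Measurable fun ω => A ω i j) (i j : Fin d) :
    Measurable fun ω => (A ω)⁻¹ i j := by
  have hA' : Measurable fun ω => (fun i j => A ω i j : Fin d → Fin d → ℝ) :=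
    measurable_pi_lambda _ fun i => measurable_pi_lambda _ fun j => hA i j
  have hdet : Continuous fun A : Fin d → Fin d → ℝ => (Matrix.of A).det :=
    Continuous.matrix_det continuous_id
  have hadj : Continuous fun A : Fin d → Fin d → ℝ => (Matrix.of A).adjugate i j :=
    (Continuous.matrix_adjugate (A := fun A : Fin d → Fin d → ℝ => Matrix.of A)
      continuous_id).matrix_elem i j
  simp only [Matrix.inv_def, Ring.inverse_eq_inv', Matrix.smul_apply, smul_eq_mul]
  exact ((hdet.measurable.comp hA').inv).mul (hadj.measurable.comp hA')

lemma measurable_olsEstimator_apply (hx : ∀ t, Measurable (x t)) (hX : ∀ t, 1 ≤ t → Measurable (X t))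
    (T : ℕ) (i : Fin d) :
    Measurable fun ω => olsEstimator (fun t => x t ω) (fun t => X t ω) T i := by
  have hx' : ∀ t i, Measurable fun ω => x t ω i := fun t i => (measurable_pi_apply i).comp (hx t)
  simp only [olsEstimator, Matrix.mulVec, dotProduct]
  refine Finset.measurable_sum _ fun j _ => ?_
  refine (measurable_matrix_inv_apply (fun k l => ?_) i j).mul ?_
  · simp only [Matrix.mul_apply]
    exact Finset.measurable_sum _ fun t _ => (hx' t k).mul (hx' t l)
  · exact Finset.measurable_sum _ fun t _ =>
      (hx' t j).mul (hX t (Finset.mem_Icc.1 t.2).1)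

lemma measurable_renyiStatistic_olsResidual (hx : ∀ t, Measurable (x t))
    (hX : ∀ t, 1 ≤ t → Measurable (X t)) (T : ℕ) (τ : ℝ) :
    Measurable fun ω =>
      renyiStatistic (olsResidual (fun t => x t ω) (fun t => X t ω) T) T τ := by
  have hres : ∀ s, 1 ≤ s →
      Measurable fun ω => olsResidual (fun t => x t ω) (fun t => X t ω) T s := by
    intro s hs
    refine (hX s hs).sub (Finset.measurable_sum _ fun i _ => ?_)
    exact ((measurable_pi_apply i).comp (hx s)).mul (measurable_olsEstimator_apply hx hX T i)
  have hsum : ∀ a b : ℕ, 1 ≤ a → Measurable fun ω => ∑ s ∈ Finset.Icc a b,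
      olsResidual (fun t => x t ω) (fun t => X t ω) T s := fun a b ha =>
    Finset.measurable_sum _ fun s hs => hres s (ha.trans (Finset.mem_Icc.1 hs).1)
  refine Measurable.iSup fun t => Measurable.abs ?_
  exact ((hsum _ _ le_rfl).const_mul _).sub ((hsum _ _ (Nat.le_add_left 1 _)).const_mul _)

end Measurability

/-! ### Assembly of the limit theorem. -/

theorem theorem3p1
    {Ω Ω' Ω'' : Type*} [MeasurableSpace Ω] [MeasurableSpace Ω'] [MeasurableSpace Ω'']
    (P : Measure Ω) [IsProbabilityMeasure P]
    (P' : Measure Ω') [IsProbabilityMeasure P']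
    (P'' : Measure Ω'') [IsProbabilityMeasure P'']
    {d : ℕ}
    -- regressors, errors, coefficients, observations
    (x : ℕ → Ω → Fin d → ℝ) (e : ℕ → Ω → ℝ) (β : ℕ → Fin d → ℝ) (X : ℕ → Ω → ℝ)
    (hx_meas : ∀ t, Measurable (x t)) (he_meas : ∀ t, Measurable (e t))
    (hmodel : ∀ t, 1 ≤ t → ∀ ω, X t ω = x t ω ⬝ᵥ β t + e t ω)
    -- the null hypothesis of no parameter change
    (hH0 : ∀ T : ℕ, ∀ s ∈ Finset.Icc 1 T, ∀ t ∈ Finset.Icc 1 T, β s = β t)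
    -- the trimming parameter
    (τ : ℕ → ℝ) (hτ_top : Tendsto τ atTop atTop)
    (hτ_zero : Tendsto (fun T : ℕ => τ T / T) atTop (𝓝 0))
    -- approximation of the partial sums of the errors
    (σ : ℝ) (hσ : 0 < σ) (happrox : WienerApproximation P e σ)
    -- regressors and errors
    (hindep : IndepFun (fun ω (t : ℕ) => x t ω) (fun ω (t : ℕ) => e t ω) P)
    (hx_erg : IsStationaryErgodic P x)
    (hx_sq : ∀ t i, MemLp (fun ω => x t ω i) 2 P)
    (hx_cov : ∃ c ζ : ℝ, 0 < c ∧ 2 < ζ ∧ ∀ (i : Fin d) (t : ℕ),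
      |covariance (fun ω => x 0 ω i) (fun ω => x t ω i) P| ≤ c * ((t : ℝ) + 1) ^ (-ζ))
    (he_sq : ∀ t, MemLp (e t) 2 P)
    (he_mean : ∫ ω, e 0 ω ∂P = 0)
    (he_cov : ∃ c ζ : ℝ, 0 < c ∧ 2 < ζ ∧ ∀ t s : ℕ,
      |∫ ω, e t ω * e s ω ∂P| ≤ c * (|(t : ℝ) - (s : ℝ)| + 1) ^ (-ζ))
    (hC : IsUnit (secondMomentMatrix P x).det)
    -- the limit variables: independent copies of the supremum of |W| over [0, 1]
    (W : ℝ → Ω' → ℝ) (hW : IsWienerOn P' 1 W)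
    (ξ₁ ξ₂ : Ω'' → ℝ) (hξ : IndepFun ξ₁ ξ₂ P'')
    (hξ₁ : IdentDistrib ξ₁ (fun ω => ⨆ u : Set.Icc (0 : ℝ) 1, |W u ω|) P'' P')
    (hξ₂ : IdentDistrib ξ₂ (fun ω => ⨆ u : Set.Icc (0 : ℝ) 1, |W u ω|) P'' P') :
    TendstoInDistribution
      (fun (T : ℕ) ω => Real.sqrt (τ T) / σ *
        renyiStatistic (olsResidual (fun t => x t ω) (fun t => X t ω) T) T (τ T))
      atTop (fun ω => max (ξ₁ ω) (ξ₂ ω)) (fun _ => P) P'' := by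
  obtain ⟨cx, ζx, hcx, hζx, hx_cov⟩ := hx_cov
  obtain ⟨ce, ζe, hce, hζe, he_cov⟩ := he_cov
  obtain ⟨κ, W₁, W₂, y₁, y₂, hκ, hκ', hW₁, hW₂, hWind, hy₁, hy₂, hy₁0, hy₂0, hy⟩ :=
    happrox.exists_bounds
  obtain ⟨Ce, hCe⟩ := exists_linearSecondMoment he_sq hce.le (by linarith) he_cov
  have hmodel' : ∀ t, 1 ≤ t → ∀ ω, X t ω = x t ω ⬝ᵥ β 1 + e t ω := by
    intro t ht ω
    rw [hmodel t ht ω, hH0 t 1 (Finset.mem_Icc.2 ⟨le_rfl, ht⟩) t (Finset.mem_Icc.2 ⟨ht, le_rfl⟩)]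
  have hX_meas : ∀ t, 1 ≤ t → Measurable (X t) := by
    intro t ht
    rw [show X t = fun ω => x t ω ⬝ᵥ β 1 + e t ω from funext (hmodel' t ht)]
    exact (Finset.measurable_sum _ fun i _ =>
      ((measurable_pi_apply i).comp (hx_meas t)).mul_const _).add (he_meas t)
  -- Finitely many initial `τ T` may be below `1`, even negative; the truncation changes nothing in
  -- the limit.
  let τ' : ℕ → ℝ := fun T => max (τ T) 1
  have hτ'_one : ∀ T, 1 ≤ τ' T := fun T => le_max_right _ _
  have hτ'_eq : ∀ᶠ T in atTop, τ' T = τ T := by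
    filter_upwards [hτ_top.eventually_ge_atTop 1] with T hT using max_eq_left hT
  have hτ'_top : Tendsto τ' atTop atTop := tendsto_atTop_mono (fun T => le_max_left _ _) hτ_top
  have hτ'_zero : Tendsto (fun T : ℕ => τ' T / T) atTop (𝓝 0) := by
    refine hτ_zero.congr' ?_
    filter_upwards [hτ'_eq] with T hT
    rw [hT]
  obtain ⟨R, hR, hR0, hRle⟩ := exists_meanDifference_error_bound hCe hσ hκ hκ' hW₁ hW₂ hy₁ hy₂
    hy₁0 hy₂0 hy hW hξ₁.aemeasurable_snd hτ'_one hτ'_top hτ'_zero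
  obtain ⟨R', B, hR', hR'0, hB, hR'le⟩ := exists_meanDifference_residual_bound hx_meas hmodel'
    hτ'_one hτ'_zero hσ hindep hx_erg hx_sq hcx hζx hx_cov he_sq hce hζe he_cov hC
  -- Slutsky: the statistic differs from the maximum of the two Wiener maxima by at most `R' + R`
  -- off `B`, which tends to `0` in probability.
  refine tendstoInDistribution_of_tendstoInMeasure_sub _ _
    (tendstoInDistribution_max_halfMax hW₁ hW₂ hWind hW hξ hξ₁ hξ₂
      (fun T => zero_lt_one.trans_le (hτ'_one T)) hτ'_top hτ'_zero) ?_
    fun T => ((measurable_renyiStatistic_olsResidual hx_meas hX_meas T (τ T)).const_mul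
      _).aemeasurable
  refine TendstoInMeasure.zero_of_le (TendstoInMeasure.add_zero hR' hR) hB ?_
  filter_upwards [hR'le, hτ'_eq] with T hT hTτ
  refine .of_forall fun ω hω => ?_
  have hτ0 : 0 < τ' T := zero_lt_one.trans_le (hτ'_one T)
  rw [abs_of_nonneg (add_nonneg (hR'0 T ω) (hR0 T ω))]
  simp only [Pi.sub_apply]
  rw [← hTτ]
  refine abs_mul_renyiStatistic_sub_max_le hτ0.le (div_pos (Real.sqrt_pos.2 hτ0) hσ)
    (add_nonneg (hR'0 T ω) (hR0 T ω)) (fun t ht => ?_) fun t ht => ?_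
  · obtain ⟨ht1, ht2⟩ := mem_trimmedHalf.1 ht
    refine (abs_sub_le _ (√(τ' T) / σ * meanDifference (fun s => e s ω) T t) _).trans ?_
    exact add_le_add (hT ω hω t ht1 (by linarith)) (hRle T ω t ht).1
  · obtain ⟨ht1, ht2⟩ := mem_trimmedHalf.1 ht
    have htT : t ≤ T := by
      have : (t : ℝ) ≤ T := ht2.trans (half_le_self (Nat.cast_nonneg T))
      exact_mod_cast this
    have hcast : ((T - t : ℕ) : ℝ) = T - t := Nat.cast_sub htT
    have h1 := hT ω hω (T - t) (by rw [hcast]; linarith) (by rw [hcast]; linarith)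
    rw [← sub_neg_eq_add]
    refine (abs_sub_le _ (√(τ' T) / σ * meanDifference (fun s => e s ω) T (T - t)) _).trans ?_
    rw [sub_neg_eq_add]
    exact add_le_add h1 (hRle T ω t ht).2
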